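/- Let $X$ be a real Banach space. A complex structure on $X$ in the isometric sense is a complex Banach space with the same underlying additive group and the same norm as $X$, whose scalar multiplication restricted to $\mathbb R$ is that of $X$. Two complex structures on $X$ are isometric if there is a $\mathbb C$-linear isometry from one onto the other; the number of complex structures on $X$ up to isometry is the number of classes for this relation. We say that $X$ admits a complex structure up to isomorphism if there is a bounded $\mathbb R$-linear operator $I$ on $X$ with $I^2=-\mathrm{Id}$. (1) If $X$ is a real Banach space with $\dim_{\mathbb R} X\ge 4$ (possibly infinite) which admits a complex structure up to isomorphism, then there is an equivalent norm on $X$ for which $X$ has exactly two complex structures up to isometry. (2) If $X$ is a real Banach space which is isomorphic to $Y\times Y$ for some real Banach space $Y$, then there is an equivalent norm on $X$ for which $X$ has exactly one complex structure up to isometry. -/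

import Mathlib

universe u v

noncomputable section

/-- An equivalent norm on a real normed space `X`: a seminorm bounded below and above by positive
multiples of the given norm. -/
structure EquivalentNorm (X : Type u) [NormedAddCommGroup X] [NormedSpace ℝ X] extends
    Seminorm ℝ X where
  exists_lower : ∃ c : ℝ, 0 < c ∧ ∀ x, c * ‖x‖ ≤ toFun x
  exists_upper : ∃ C : ℝ, 0 < C ∧ ∀ x, toFun x ≤ C * ‖x‖

namespace EquivalentNorm

variable {X : Type u} [NormedAddCommGroup X] [NormedSpace ℝ X]

/-- The real vector space `X` equipped with the equivalent norm `N`. -/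
def Space (_N : EquivalentNorm X) : Type u := X

instance (N : EquivalentNorm X) : AddCommGroup N.Space := inferInstanceAs (AddCommGroup X)

instance (N : EquivalentNorm X) : Module ℝ N.Space := inferInstanceAs (Module ℝ X)

instance (N : EquivalentNorm X) : Norm N.Space := ⟨fun x => N.toSeminorm x⟩

theorem core (N : EquivalentNorm X) : NormedSpace.Core ℝ N.Space where
  norm_nonneg x := apply_nonneg N.toSeminorm x
  norm_smul r x := map_smul_eq_mul N.toSeminorm r x
  norm_triangle x y := map_add_le_add N.toSeminorm x y
  norm_eq_zero_iff x := by
    constructor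
    · intro h
      obtain ⟨c, hc, hN⟩ := N.exists_lower
      have h1 : c * @norm X _ x ≤ 0 := (hN x).trans_eq h
      have h2 : @norm X _ x ≤ 0 := by
        by_contra h3
        exact absurd h1 (not_le.mpr (mul_pos hc (not_le.mp h3)))
      exact norm_le_zero_iff.mp h2
    · rintro rfl
      exact map_zero N.toSeminorm

instance (N : EquivalentNorm X) : NormedAddCommGroup N.Space :=
  NormedAddCommGroup.ofCore N.core

instance (N : EquivalentNorm X) : NormedSpace ℝ N.Space :=
  NormedSpace.ofCore N.core

end EquivalentNorm

/-- A complex structure, in the isometric sense, on a real normed space `X`: a complex normed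
space structure on `X`, for the same addition and the same norm, whose restriction to real scalars
is the given real linear structure. (If `X` is complete, this is a complex Banach space.) -/
structure ComplexStructure (X : Type u) [NormedAddCommGroup X] [NormedSpace ℝ X] where
  normedSpace : NormedSpace ℂ X
  ofReal_smul : ∀ (r : ℝ) (x : X), (r : ℂ) • x = r • x

namespace ComplexStructure

variable {X : Type u} [NormedAddCommGroup X] [NormedSpace ℝ X]

/-- The complex normed space given by a complex structure. -/
def Space (_S : ComplexStructure X) : Type u := X

instance (S : ComplexStructure X) : NormedAddCommGroup S.Space :=
  inferInstanceAs (NormedAddCommGroup X)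

instance (S : ComplexStructure X) : NormedSpace ℂ S.Space := S.normedSpace

/-- Two complex structures are isometric if there is a surjective `ℂ`-linear isometry between the
corresponding complex normed spaces. -/
def isometricSetoid (X : Type u) [NormedAddCommGroup X] [NormedSpace ℝ X] :
    Setoid (ComplexStructure X) where
  r S T := Nonempty (S.Space ≃ₗᵢ[ℂ] T.Space)
  iseqv :=
    { refl := fun S => ⟨LinearIsometryEquiv.refl ℂ S.Space⟩
      symm := fun ⟨e⟩ => ⟨e.symm⟩
      trans := fun ⟨e⟩ ⟨f⟩ => ⟨e.trans f⟩ }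

end ComplexStructure

/-- The complex structures on `X` up to isometry. -/
def ComplexStructuresUpToIsometry (X : Type u) [NormedAddCommGroup X] [NormedSpace ℝ X] :
    Type u :=
  Quotient (ComplexStructure.isometricSetoid X)

/-- `X` admits a complex structure up to isomorphism: there is a bounded real operator on `X`
whose square is `-Id` (such an operator is automatically an isomorphism). -/
def HasComplexStructureUpToIsomorphism (X : Type u) [NormedAddCommGroup X] [NormedSpace ℝ X] :
    Prop :=
  ∃ I : X →L[ℝ] X, I.comp I = -ContinuousLinearMap.id ℝ X

end

/-! A complex structure in the isometric sense amounts to a real operator J with J² = -1 and ‖ax +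
bJx‖ = |a + bi|‖x‖. Starting from one complex space W isomorphic to X, it is enough to renorm W so
that multiplications by i and -i are the only such operators. There is then one class or there are
two, according to whether an antilinear isometry exists.

The new norm is the supremum of the old norm and of the moduli of a family of complex functionals,
so i stays isometric. Near a point where one functional F dominates by a margin the norm is |F|, and
invariance under J then forces F ∘ J = iF or F ∘ J = -iF (`mem_eigenDual_or_of_eventually`). The
family is built so that all these signs agree. Around each vector of a bounded biorthogonal system
(x_a, f_a) three faces (1+ε)f_a + εωh_a, ω = i, -i, 1, are exposed; their linear dependence gives
f_a and h_a a common sign (`PeakData.exists_sign`). Up to a scalar and a multiple of f_a, h_a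
encodes a chosen functional; if both u and u + σ are encoded, u has the sign of σ
(`PeakData.Linked.mem_eigenDual`). A system long enough to encode a total set in this way comes from
Zorn's lemma and a cardinality count (`exists_linkedSystem`).

For a square, W is the complexification of a space ℝ × Z and the family is stable under conjugation,
which is thus an antilinear isometry. For exactly two structures, real dimension at least 4 gives
room for a plane ℂ² in W, which carries four special functionals. For tiny ε these are, up to
unimodular factors, the only functionals giving the norm on a ball of fixed size at height 2
(`LinkedSystem.exists_eq_special_of_isFlat`). An antilinear isometry would permute them, which their
position excludes (`PlaneSum.vec_chiral`). -/

namespace ComplexStructure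

/-! ### Complex structures as real operators of square -1. -/

variable {V : Type u} [NormedAddCommGroup V] [NormedSpace ℝ V]

/-- Multiplication by `i` in a complex structure, as a real linear map. -/
def mulI (S : ComplexStructure V) : V →ₗ[ℝ] V :=
  letI := S.normedSpace
  { toFun := fun x => Complex.I • x
    map_add' := fun x y => smul_add _ x y
    map_smul' := fun r x => by
      simp only [RingHom.id_apply]
      rw [← S.ofReal_smul, ← S.ofReal_smul, smul_comm] }

theorem smul_eq (S : ComplexStructure V) (z : ℂ) (x : V) :
    S.normedSpace.smul z x = z.re • x + z.im • S.mulI x := by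
  let _ := S.normedSpace
  change z • x = z.re • x + z.im • (Complex.I • x)
  rw [← S.ofReal_smul, ← S.ofReal_smul, smul_smul, ← add_smul, Complex.re_add_im]

theorem mulI_mulI (S : ComplexStructure V) (x : V) : S.mulI (S.mulI x) = -x := by
  let _ := S.normedSpace
  change Complex.I • (Complex.I • x) = -x
  rw [smul_smul, Complex.I_mul_I, neg_one_smul]

theorem norm_mulI (S : ComplexStructure V) (a b : ℝ) (x : V) :
    ‖a • x + b • S.mulI x‖ = ‖(⟨a, b⟩ : ℂ)‖ * ‖x‖ := by
  rw [← S.smul_eq ⟨a, b⟩ x]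
  let _ := S.normedSpace
  exact norm_smul (⟨a, b⟩ : ℂ) x

/-- The complex structure in which multiplication by `i` is a given operator. -/
def ofMulI (I : V →ₗ[ℝ] V) (hI : ∀ x, I (I x) = -x)
    (hn : ∀ (a b : ℝ) (x : V), ‖a • x + b • I x‖ = ‖(⟨a, b⟩ : ℂ)‖ * ‖x‖) :
    ComplexStructure V where
  normedSpace :=
    { smul := fun z x => z.re • x + z.im • I x
      one_smul := fun x => by
        change (1 : ℂ).re • x + (1 : ℂ).im • I x = x
        simp
      mul_smul := fun z w x => by
        change (z * w).re • x + (z * w).im • I x =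
          z.re • (w.re • x + w.im • I x) + z.im • I (w.re • x + w.im • I x)
        simp only [Complex.mul_re, Complex.mul_im, map_add, map_smul, hI]
        module
      smul_zero := fun z => by
        change z.re • (0 : V) + z.im • I 0 = 0
        simp
      smul_add := fun z x y => by
        change z.re • (x + y) + z.im • I (x + y) = (z.re • x + z.im • I x) + (z.re • y + z.im • I y)
        simp only [map_add]
        module
      add_smul := fun z w x => by
        change (z + w).re • x + (z + w).im • I x = (z.re • x + z.im • I x) + (w.re • x + w.im • I x)
        simp only [Complex.add_re, Complex.add_im]
        module
      zero_smul := fun x => by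
        change (0 : ℂ).re • x + (0 : ℂ).im • I x = 0
        simp
      norm_smul_le := fun z x => (hn z.re z.im x).le }
  ofReal_smul := fun r x => by
    change (r : ℂ).re • x + (r : ℂ).im • I x = r • x
    simp

theorem mulI_ofMulI (I : V →ₗ[ℝ] V) (hI hn) : (ofMulI I hI hn).mulI = I := by
  ext x
  change (Complex.I).re • x + (Complex.I).im • I x = I x
  simp

theorem isometric_of (S T : ComplexStructure V) (e : V ≃ₗ[ℝ] V) (hn : ∀ x, ‖e x‖ = ‖x‖)
    (he : ∀ x, e (S.mulI x) = T.mulI (e x)) : (isometricSetoid V).r S T := by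
  refine ⟨{ toFun := fun x => e x, invFun := fun x => e.symm x, map_add' := ?_, map_smul' := ?_,
            left_inv := e.left_inv, right_inv := e.right_inv, norm_map' := hn }⟩
  · intro x y
    exact e.map_add x y
  · intro z x
    have h (x : V) : e (z.re • x + z.im • S.mulI x) = z.re • e x + z.im • T.mulI (e x) := by
      rw [map_add, map_smul, map_smul, he]
    exact (congrArg e (S.smul_eq z x)).trans ((h x).trans (T.smul_eq z (e x)).symm)

theorem exists_of_isometric {S T : ComplexStructure V} (h : (isometricSetoid V).r S T) :
    ∃ e : V ≃ₗ[ℝ] V, (∀ x, ‖e x‖ = ‖x‖) ∧ ∀ x, e (S.mulI x) = T.mulI (e x) := by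
  obtain ⟨f⟩ := h
  have hs : ∀ (z : ℂ) (x : V), f (S.normedSpace.smul z x) = T.normedSpace.smul z (f x) :=
    fun z x => f.map_smul z x
  refine ⟨{ toFun := fun x => f x, invFun := fun x => f.symm x, map_add' := ?_, map_smul' := ?_,
            left_inv := f.left_inv, right_inv := f.right_inv }, f.norm_map, ?_⟩
  · intro x y
    exact f.map_add x y
  · intro r x
    have hS : S.normedSpace.smul r x = r • x := S.ofReal_smul r x
    exact (congrArg f hS.symm).trans ((hs r x).trans (T.ofReal_smul r (f x)))
  · intro x
    exact hs Complex.I x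

end ComplexStructure

/-! ### Counting classes when only I and -I are isometric structures. -/

section Counting

variable {V : Type u} [NormedAddCommGroup V] [NormedSpace ℝ V] (I : V →ₗ[ℝ] V)
  (hI : ∀ x, I (I x) = -x)
  (hn : ∀ (a b : ℝ) (x : V), ‖a • x + b • I x‖ = ‖(⟨a, b⟩ : ℂ)‖ * ‖x‖)
  (hJ : ∀ J : V →ₗ[ℝ] V, (∀ x, J (J x) = -x) →
    (∀ (a b : ℝ) (x : V), ‖a • x + b • J x‖ = ‖(⟨a, b⟩ : ℂ)‖ * ‖x‖) → J = I ∨ J = -I)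

include hI hn hJ

open ComplexStructure in
theorem card_complexStructures_eq_one
    (hT : ∃ T : V ≃ₗ[ℝ] V, (∀ x, ‖T x‖ = ‖x‖) ∧ ∀ x, T (I x) = -I (T x)) :
    Nat.card (ComplexStructuresUpToIsometry V) = 1 := by
  obtain ⟨T, hT, hTI⟩ := hT
  rw [Nat.card_eq_one_iff_unique]
  have key : ∀ S : ComplexStructure V, (isometricSetoid V).r (ofMulI I hI hn) S := by
    intro S
    rcases hJ S.mulI S.mulI_mulI S.norm_mulI with h | h
    · refine isometric_of _ _ (LinearEquiv.refl ℝ V) (fun x => rfl) fun x => ?_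
      rw [mulI_ofMulI, h]
      rfl
    · refine isometric_of _ _ T hT fun x => ?_
      rw [mulI_ofMulI, h]
      exact hTI x
  refine ⟨⟨fun a b => ?_⟩, ⟨Quotient.mk (isometricSetoid V) (ofMulI I hI hn)⟩⟩
  induction a using Quotient.inductionOn
  induction b using Quotient.inductionOn
  exact Quotient.sound ((isometricSetoid V).iseqv.trans
    ((isometricSetoid V).iseqv.symm (key _)) (key _))

open ComplexStructure in
-- An isometry between the structures of I and -I is exactly an isometry anticommuting with I, so
-- excluding the latter keeps the two classes apart.
theorem card_complexStructures_eq_two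
    (hT : ¬∃ T : V ≃ₗ[ℝ] V, (∀ x, ‖T x‖ = ‖x‖) ∧ ∀ x, T (I x) = -I (T x)) :
    Nat.card (ComplexStructuresUpToIsometry V) = 2 := by
  have hn' : ∀ (a b : ℝ) (x : V), ‖a • x + b • (-I) x‖ = ‖(⟨a, b⟩ : ℂ)‖ * ‖x‖ := by
    intro a b x
    have := hn a (-b) x
    rw [LinearMap.neg_apply, smul_neg, ← neg_smul, this]
    congr 1
    rw [← Complex.norm_conj]
    congr 1
    apply Complex.ext <;> simp
  have hI' : ∀ x, (-I) ((-I) x) = -x := fun x => by simp [hI]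
  rw [Nat.card_eq_two_iff]
  refine ⟨Quotient.mk (isometricSetoid V) (ofMulI I hI hn),
    Quotient.mk (isometricSetoid V) (ofMulI (-I) hI' hn'), ?_, ?_⟩
  · intro h
    obtain ⟨e, he, heI⟩ := exists_of_isometric (Quotient.exact h)
    refine hT ⟨e, he, fun x => ?_⟩
    have := heI x
    rwa [mulI_ofMulI, mulI_ofMulI] at this
  · rw [Set.eq_univ_iff_forall]
    intro a
    induction a using Quotient.inductionOn with
    | h S =>
      rcases hJ S.mulI S.mulI_mulI S.norm_mulI with h | h
      · left
        refine Quotient.sound (isometric_of _ _ (LinearEquiv.refl ℝ V) (fun x => rfl) fun x => ?_)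
        rw [mulI_ofMulI, h]
        rfl
      · right
        refine Quotient.sound (isometric_of _ _ (LinearEquiv.refl ℝ V) (fun x => rfl) fun x => ?_)
        rw [mulI_ofMulI, h]
        rfl

end Counting

open Filter Topology

/-! ### Norms defined by adjoining functionals. -/

section SupNorm

variable {W : Type*} [NormedAddCommGroup W] [NormedSpace ℂ W] {ι : Type*}
  {G : ι → W →L[ℂ] ℂ} {C : ℝ}

/-- The maximum of the norm and of the moduli of a family of functionals. -/
noncomputable def supNorm (G : ι → W →L[ℂ] ℂ) (x : W) : ℝ := max ‖x‖ (⨆ i, ‖G i x‖)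

theorem bddAbove_norm_apply (hC : ∀ i, ‖G i‖ ≤ C) (x : W) :
    BddAbove (Set.range fun i => ‖G i x‖) := by
  refine ⟨C * ‖x‖, ?_⟩
  rintro _ ⟨i, rfl⟩
  exact (G i).le_of_opNorm_le (hC i) x

theorem norm_le_supNorm (x : W) : ‖x‖ ≤ supNorm G x := le_max_left _ _

theorem norm_apply_le_supNorm (hC : ∀ i, ‖G i‖ ≤ C) (i : ι) (x : W) : ‖G i x‖ ≤ supNorm G x :=
  (le_ciSup (bddAbove_norm_apply hC x) i).trans (le_max_right _ _)

theorem supNorm_le {x : W} {r : ℝ} (h : ‖x‖ ≤ r) (hG : ∀ i, ‖G i x‖ ≤ r) : supNorm G x ≤ r :=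
  max_le h (Real.iSup_le hG ((norm_nonneg x).trans h))

theorem supNorm_le_mul (hC : ∀ i, ‖G i‖ ≤ C) (h1 : 1 ≤ C) (x : W) : supNorm G x ≤ C * ‖x‖ :=
  supNorm_le (le_mul_of_one_le_left (norm_nonneg x) h1) fun i => (G i).le_of_opNorm_le (hC i) x

theorem supNorm_add_le (hC : ∀ i, ‖G i‖ ≤ C) (x y : W) :
    supNorm G (x + y) ≤ supNorm G x + supNorm G y := by
  refine supNorm_le ((norm_add_le x y).trans (add_le_add (norm_le_supNorm x) (norm_le_supNorm y)))
    fun i => ?_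
  rw [map_add]
  exact (norm_add_le _ _).trans
    (add_le_add (norm_apply_le_supNorm hC i x) (norm_apply_le_supNorm hC i y))

/-- Only moduli of complex-linear functionals are adjoined, so the original complex structure stays
isometric. -/
theorem supNorm_smul_complex (z : ℂ) (x : W) : supNorm G (z • x) = ‖z‖ * supNorm G x := by
  simp only [supNorm, norm_smul, map_smul]
  rw [mul_max_of_nonneg _ _ (norm_nonneg z), Real.mul_iSup_of_nonneg (norm_nonneg z)]

theorem supNorm_smul_real (r : ℝ) (x : W) : supNorm G (r • x) = ‖r‖ * supNorm G x := by
  rw [← Complex.coe_smul, supNorm_smul_complex, Complex.norm_real]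

theorem supNorm_neg (x : W) : supNorm G (-x) = supNorm G x := by
  simp [supNorm]

/-- Around a point at which one functional dominates all the others by a margin, the norm is the
modulus of that functional. -/
theorem supNorm_eq_of_peak (hC : ∀ i, ‖G i‖ ≤ C) {x₀ y : W} {i : ι} {η : ℝ}
    (h0 : ‖x₀‖ + η ≤ ‖G i x₀‖)
    (hj : ∀ j, (∀ y, ‖G j y‖ = ‖G i y‖) ∨ ‖G j x₀‖ + η ≤ ‖G i x₀‖)
    (hy : supNorm G (y - x₀) ≤ η / 2) : supNorm G y = ‖G i y‖ := by
  -- The dominant value drops by at most η/2 and every competitor rises by at most η/2, so a gap of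
  -- η is not overturned.
  have key : ∀ j, ‖G j (y - x₀)‖ ≤ η / 2 := fun j => (norm_apply_le_supNorm hC j _).trans hy
  have hi : ‖G i x₀‖ - η / 2 ≤ ‖G i y‖ := by
    have h1 := key i
    rw [map_sub, norm_sub_rev] at h1
    linarith [norm_sub_norm_le (G i x₀) (G i y)]
  refine le_antisymm (supNorm_le ?_ fun j => ?_) (norm_apply_le_supNorm hC i y)
  · linarith [norm_sub_norm_le y x₀, (norm_le_supNorm (G := G) (y - x₀)).trans hy]
  · rcases hj j with h | h
    · exact (h y).le
    · have h1 := key j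
      rw [map_sub] at h1
      linarith [norm_sub_norm_le (G j y) (G j x₀)]

theorem eventually_supNorm_eq (hC : ∀ i, ‖G i‖ ≤ C) {x₀ : W} {i : ι} {η : ℝ} (hη : 0 < η)
    (h0 : ‖x₀‖ + η ≤ ‖G i x₀‖)
    (hj : ∀ j, (∀ y, ‖G j y‖ = ‖G i y‖) ∨ ‖G j x₀‖ + η ≤ ‖G i x₀‖) :
    ∀ᶠ y in 𝓝 x₀, supNorm G y = ‖G i y‖ := by
  have hpos : 0 < η / 2 / max 1 C := by positivity
  filter_upwards [Metric.ball_mem_nhds x₀ hpos] with y hy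
  refine supNorm_eq_of_peak hC h0 hj ?_
  refine (supNorm_le_mul (fun j => (hC j).trans (le_max_right 1 C)) (le_max_left 1 C) _).trans ?_
  rw [mem_ball_iff_norm, lt_div_iff₀ (by positivity)] at hy
  linarith

end SupNorm

/-! ### The sign with which a complex structure acts on a functional. -/

section Sign

variable {W : Type*} [NormedAddCommGroup W] [NormedSpace ℂ W]

/-- The functionals which turn a real linear operator into multiplication by a scalar. -/
def eigenDual (J : W →ₗ[ℝ] W) (c : ℂ) : Submodule ℂ (W →L[ℂ] ℂ) where
  carrier := {F | ∀ x, F (J x) = c * F x}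
  add_mem' {F H} hF hH x := by
    rw [add_apply, add_apply, hF x, hH x, mul_add]
  zero_mem' x := by simp
  smul_mem' a F hF x := by
    simp only [smul_apply, smul_eq_mul, hF x]
    ring

theorem mem_eigenDual {J : W →ₗ[ℝ] W} {c : ℂ} {F : W →L[ℂ] ℂ} :
    F ∈ eigenDual J c ↔ ∀ x, F (J x) = c * F x := Iff.rfl

/-- Orthogonal plane vectors of equal length differ by a quarter turn. Algebraically, the product of
the two alternatives is v² + w², whose real and imaginary parts, multiplied by |w|², are
combinations of the hypotheses. -/
theorem eq_I_mul_or_of_norm_eq {w v : ℂ} (h1 : ‖v‖ ^ 2 = ‖w‖ ^ 2)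
    (h2 : w.re * v.re + w.im * v.im = 0) : v - Complex.I * w = 0 ∨ v + Complex.I * w = 0 := by
  rw [← mul_eq_zero]
  rw [← Complex.normSq_eq_norm_sq, ← Complex.normSq_eq_norm_sq, Complex.normSq_apply,
    Complex.normSq_apply] at h1
  have h3 : v.im * (w.re * v.re + w.im * v.im) = 0 := by rw [h2, mul_zero]
  have h4 : v.re * (w.re * v.re + w.im * v.im) = 0 := by rw [h2, mul_zero]
  have h5 : w.im * (w.re * v.re + w.im * v.im) = 0 := by rw [h2, mul_zero]
  have h6 : w.re * (w.re * v.re + w.im * v.im) = 0 := by rw [h2, mul_zero]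
  have h7 : (v - Complex.I * w) * (v + Complex.I * w) = v ^ 2 + w ^ 2 := by
    linear_combination (-w ^ 2) * Complex.I_sq
  rw [h7]
  by_cases hw : w = 0
  · subst hw
    have : v = 0 := by
      rw [← Complex.normSq_eq_zero, Complex.normSq_apply, h1]
      simp
    simp [this]
  · have hpos : 0 < w.re * w.re + w.im * w.im := by
      rw [← Complex.normSq_apply]
      exact Complex.normSq_pos.mpr hw
    have hA : v.re ^ 2 - v.im ^ 2 + w.re ^ 2 - w.im ^ 2 = 0 := by
      have : (w.re * w.re + w.im * w.im) * (v.re ^ 2 - v.im ^ 2 + w.re ^ 2 - w.im ^ 2) = 0 := by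
        linear_combination (w.im ^ 2 - w.re ^ 2) * (h1) + 2 * (w.re * v.re - w.im * v.im) * h2
      exact (mul_eq_zero.mp this).resolve_left hpos.ne'
    have hB : v.re * v.im + w.re * w.im = 0 := by
      have : (w.re * w.re + w.im * w.im) * (v.re * v.im + w.re * w.im) = 0 := by
        linear_combination (-w.re * w.im) * (h1) + (w.re * v.im + w.im * v.re) * h2
      exact (mul_eq_zero.mp this).resolve_left hpos.ne'
    apply Complex.ext
    · simp only [pow_two, Complex.add_re, Complex.mul_re, Complex.zero_re]
      linarith
    · simp only [pow_two, Complex.add_im, Complex.mul_im, Complex.zero_im]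
      linarith

/-- If a norm which is invariant under the complex structure `J` is locally the modulus of a
functional, then that functional turns `J` into multiplication by `i` or by `-i`. -/
theorem mem_eigenDual_or_of_eventually {q : W → ℝ} {J : W →ₗ[ℝ] W}
    (hq : ∀ (a b : ℝ) (x : W), q (a • x + b • J x) = ‖(⟨a, b⟩ : ℂ)‖ * q x)
    {F : W →L[ℂ] ℂ} {x₀ : W} (h : ∀ᶠ y in 𝓝 x₀, q y = ‖F y‖) :
    F ∈ eigenDual J Complex.I ∨ F ∈ eigenDual J (-Complex.I) := by
  have line (x v : W) {P : W → Prop} (hP : ∀ᶠ y in 𝓝 x, P y) :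
      ∃ t : ℝ, 0 < t ∧ P (x + t • v) ∧ P (x + (-t) • v) := by
    have hc : Tendsto (fun t : ℝ => x + t • v) (𝓝 0) (𝓝 x) := by
      have : Continuous fun t : ℝ => x + t • v := by fun_prop
      simpa using this.tendsto 0
    obtain ⟨r, hr, hball⟩ := Metric.eventually_nhds_iff.mp (hc.eventually hP)
    refine ⟨r / 2, by positivity, hball ?_, hball ?_⟩ <;>
      simp [abs_of_pos hr, hr]
  -- Comparing |F(x + sJx)|² with (1 + s²)|F x|² at s = ±t: the odd part gives orthogonality of F x
  -- and F(Jx), the even part equality of their moduli.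
  have loc : ∀ᶠ x in 𝓝 x₀,
      (F (J x) - Complex.I * F x) * (F (J x) + Complex.I * F x) = 0 := by
    filter_upwards [h.eventually_nhds] with x hx
    obtain ⟨t, ht, h1, h2⟩ := line x (J x) hx
    have hx0 := hx.self_of_nhds
    have e (s : ℝ) (hs : q (x + s • J x) = ‖F (x + s • J x)‖) :
        (1 + s ^ 2) * ‖F x‖ ^ 2 = ‖F x‖ ^ 2 +
          2 * s * ((F x).re * (F (J x)).re + (F x).im * (F (J x)).im) +
          s ^ 2 * ‖F (J x)‖ ^ 2 := by
      have h3 := hq 1 s x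
      rw [one_smul, hs, hx0] at h3
      have h4 := congrArg (· ^ 2) h3
      simp only [mul_pow] at h4
      rw [map_add, ← Complex.coe_smul, map_smul, smul_eq_mul] at h4
      simp only [← Complex.normSq_eq_norm_sq, Complex.normSq_apply, Complex.add_re, Complex.add_im,
        Complex.mul_re, Complex.mul_im, Complex.ofReal_re, Complex.ofReal_im] at h4 ⊢
      linear_combination -h4
    have e1 := e t h1
    have e2 := e (-t) h2
    have h5 : (F x).re * (F (J x)).re + (F x).im * (F (J x)).im = 0 := by
      have : t * ((F x).re * (F (J x)).re + (F x).im * (F (J x)).im) = 0 := by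
        linear_combination (-e1 + e2) / 4
      exact (mul_eq_zero.mp this).resolve_left ht.ne'
    have h6 : ‖F (J x)‖ ^ 2 = ‖F x‖ ^ 2 := by
      have : t ^ 2 * (‖F (J x)‖ ^ 2 - ‖F x‖ ^ 2) = 0 := by
        linear_combination (-e1 - e2) / 2
      exact sub_eq_zero.mp ((mul_eq_zero.mp this).resolve_left (by positivity))
    exact mul_eq_zero.mpr (eq_I_mul_or_of_norm_eq h6 h5)
  -- The product is a homogeneous quadratic expression vanishing near x₀, so its second difference
  -- along v, which is its value at v up to a factor, vanishes too.
  have glob (v : W) : (F (J v) - Complex.I * F v) * (F (J v) + Complex.I * F v) = 0 := by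
    obtain ⟨t, ht, h1, h2⟩ := line x₀ v loc
    have h0 := loc.self_of_nhds
    have hlin (s : ℝ) : F (s • v) = s * F v := by
      rw [← Complex.coe_smul, map_smul, smul_eq_mul]
    have hlin' (s : ℝ) : F (s • J v) = s * F (J v) := by
      rw [← Complex.coe_smul, map_smul, smul_eq_mul]
    simp only [map_add, map_smul, hlin, hlin'] at h1 h2
    have ht' : (t : ℂ) ≠ 0 := by exact_mod_cast ht.ne'
    have : (t : ℂ) ^ 2 * ((F (J v) - Complex.I * F v) * (F (J v) + Complex.I * F v)) = 0 := by
      push_cast at h1 h2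
      linear_combination (h1 + h2 - 2 * h0) / 2
    exact (mul_eq_zero.mp this).resolve_left (pow_ne_zero 2 ht')
  -- The real subspaces where either factor vanishes cover the space; a vector space is not the
  -- union of two proper subspaces.
  by_contra hcon
  rw [not_or] at hcon
  simp only [mem_eigenDual, not_forall] at hcon
  obtain ⟨⟨v, hv⟩, w, hw⟩ := hcon
  have hv' : F (J v) - Complex.I * F v ≠ 0 := sub_ne_zero.mpr hv
  have hw' : F (J w) + Complex.I * F w ≠ 0 := fun h0 => hw (by linear_combination h0)
  have hv2 := (mul_eq_zero.mp (glob v)).resolve_left hv'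
  have hw2 := (mul_eq_zero.mp (glob w)).resolve_right hw'
  have hvw := glob (v + w)
  simp only [map_add] at hvw
  refine mul_ne_zero hv' hw' ?_
  linear_combination hvw - (F (J v) + F (J w) - Complex.I * (F v + F w)) * hv2 -
    (F (J w) + Complex.I * F w) * hw2

theorem eq_zero_of_mem_eigenDual {J : W →ₗ[ℝ] W} {F : W →L[ℂ] ℂ}
    (h1 : F ∈ eigenDual J Complex.I) (h2 : F ∈ eigenDual J (-Complex.I)) : F = 0 := by
  ext x
  have h := (h1 x).symm.trans (h2 x)
  have h3 : 2 * Complex.I * F x = 0 := by linear_combination h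
  simpa using h3

/-- Two nonzero functionals of definite sign have the same sign if some combination of them with
nonzero coefficients has a sign. -/
theorem mem_eigenDual_and_of_combination {J : W →ₗ[ℝ] W} {F H : W →L[ℂ] ℂ} {c d : ℂ}
    (hc : c ≠ 0) (hd : d ≠ 0) (hF0 : F ≠ 0) (hH0 : H ≠ 0)
    (hF : F ∈ eigenDual J Complex.I ∨ F ∈ eigenDual J (-Complex.I))
    (hH : H ∈ eigenDual J Complex.I ∨ H ∈ eigenDual J (-Complex.I))
    (hS : c • F + d • H ∈ eigenDual J Complex.I ∨ c • F + d • H ∈ eigenDual J (-Complex.I)) :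
    (F ∈ eigenDual J Complex.I ∧ H ∈ eigenDual J Complex.I) ∨
      (F ∈ eigenDual J (-Complex.I) ∧ H ∈ eigenDual J (-Complex.I)) := by
  have left {s : ℂ} (h : c • F + d • H ∈ eigenDual J s) (h' : F ∈ eigenDual J s) :
      H ∈ eigenDual J s :=
    (Submodule.smul_mem_iff _ hd).mp
      ((Submodule.add_mem_iff_right _ (Submodule.smul_mem _ c h')).mp h)
  have right {s : ℂ} (h : c • F + d • H ∈ eigenDual J s) (h' : H ∈ eigenDual J s) :
      F ∈ eigenDual J s :=
    (Submodule.smul_mem_iff _ hc).mp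
      ((Submodule.add_mem_iff_left _ (Submodule.smul_mem _ d h')).mp h)
  -- With opposite signs, the combination would give F or H both signs at once, and that functional
  -- would vanish.
  rcases hF with hF | hF <;> rcases hH with hH | hH <;> rcases hS with hS | hS
  · exact Or.inl ⟨hF, hH⟩
  · exact Or.inl ⟨hF, hH⟩
  · exact absurd (eq_zero_of_mem_eigenDual (left hS hF) hH) hH0
  · exact absurd (eq_zero_of_mem_eigenDual hF (right hS hH)) hF0
  · exact absurd (eq_zero_of_mem_eigenDual (right hS hH) hF) hF0
  · exact absurd (eq_zero_of_mem_eigenDual hH (left hS hF)) hH0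
  · exact Or.inr ⟨hF, hH⟩
  · exact Or.inr ⟨hF, hH⟩

end Sign

/-! ### Exposed faces attached to a biorthogonal system. -/

/-- A bounded biorthogonal system of vectors `x` and functionals `f`, together with functionals
`u + c • σ` to be attached to the members of the system. -/
structure PeakData (W : Type*) [NormedAddCommGroup W] [NormedSpace ℂ W] (A : Type*) where
  x : A → W
  f : A → W →L[ℂ] ℂ
  u : A → W →L[ℂ] ℂ
  c : A → ℂ
  σ : W →L[ℂ] ℂ
  norm_x : ∀ a, ‖x a‖ ≤ 1
  norm_f : ∀ a, ‖f a‖ ≤ 1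
  norm_u : ∀ a, ‖u a‖ ≤ 1
  norm_c : ∀ a, ‖c a‖ ≤ 1
  norm_σ : ‖σ‖ ≤ 1
  f_self : ∀ a, f a (x a) = 1
  f_ne : ∀ a b, a ≠ b → f a (x b) = 0
  σ_x : ∀ a, σ (x a) = 0

namespace PeakData

variable {W : Type*} [NormedAddCommGroup W] [NormedSpace ℂ W] {A : Type*} (D : PeakData W A)

/-- The attached functional, corrected so that it vanishes at the vector of the same index. -/
noncomputable def h (a : A) : W →L[ℂ] ℂ :=
  (4⁻¹ : ℂ) • (D.u a + D.c a • D.σ - D.u a (D.x a) • D.f a)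

theorem norm_h (a : A) : ‖D.h a‖ ≤ 1 := by
  have h1 : ‖D.c a • D.σ‖ ≤ 1 := by
    rw [norm_smul]
    exact mul_le_one₀ (D.norm_c a) (norm_nonneg _) D.norm_σ
  have h2 : ‖D.u a (D.x a)‖ ≤ 1 :=
    ((D.u a).le_of_opNorm_le (D.norm_u a) _).trans (by simpa using D.norm_x a)
  have h3 : ‖D.u a (D.x a) • D.f a‖ ≤ 1 := by
    rw [norm_smul]
    exact mul_le_one₀ h2 (norm_nonneg _) (D.norm_f a)
  have h4 := norm_sub_le (D.u a + D.c a • D.σ) (D.u a (D.x a) • D.f a)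
  have h5 := norm_add_le (D.u a) (D.c a • D.σ)
  have h6 := D.norm_u a
  rw [h, norm_smul, norm_inv, Complex.norm_ofNat]
  linarith

/-- Because of this the three faces at `a` agree at `x a`, and an arbitrarily small displacement can
single out any one of them. -/
theorem h_x (a : A) : D.h a (D.x a) = 0 := by
  simp [h, D.f_self, D.σ_x]

/-- Three distinct unimodular numbers, permuted by conjugation. -/
noncomputable def phase : Fin 3 → ℂ := ![Complex.I, -Complex.I, 1]

theorem norm_phase (k : Fin 3) : ‖phase k‖ = 1 := by
  fin_cases k <;> simp [phase]

/-- Distinct phases are at least a right angle apart, which separates the three faces. -/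
theorem phase_mul_conj_re {k l : Fin 3} (hkl : l ≠ k) :
    (phase l * (starRingEnd ℂ) (phase k)).re ≤ 0 := by
  fin_cases k <;> fin_cases l <;> simp_all [phase]

theorem phase_mul_conj_self (k : Fin 3) : phase k * (starRingEnd ℂ) (phase k) = 1 := by
  rw [Complex.mul_conj, Complex.normSq_eq_norm_sq, norm_phase]
  simp

/-- The functionals which define the faces of the new unit ball. -/
noncomputable def g (ε : ℝ) (p : A × Fin 3) : W →L[ℂ] ℂ :=
  (1 + ε : ℂ) • D.f p.1 + (ε * phase p.2 : ℂ) • D.h p.1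

theorem g_apply (ε : ℝ) (a : A) (k : Fin 3) (y : W) :
    D.g ε (a, k) y = (1 + ε) * D.f a y + ε * phase k * D.h a y := by
  simp [g]

variable {ε : ℝ}

theorem norm_g (hε : 0 < ε) (p : A × Fin 3) : ‖D.g ε p‖ ≤ 1 + 2 * ε := by
  have h1 : ‖(1 + ε : ℂ)‖ = 1 + ε := by
    rw [← Complex.ofReal_one, ← Complex.ofReal_add, Complex.norm_real, Real.norm_of_nonneg]
    linarith
  have h2 : ‖(ε * phase p.2 : ℂ)‖ = ε := by
    rw [norm_mul, norm_phase, mul_one, Complex.norm_real, Real.norm_of_nonneg hε.le]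
  refine (norm_add_le _ _).trans ?_
  rw [norm_smul, norm_smul, h1, h2]
  nlinarith [D.norm_f p.1, D.norm_h p.1]

/-- A term at an obtuse or right angle contributes no cross term, so |P + Qζ|² ≤ P² + Q² ≤ (P +
3Q/4)²: at least Q/4 is lost compared with the aligned sum. -/
theorem norm_add_mul_le {P Q η : ℝ} {ζ : ℂ} (hP : 0 ≤ P) (hQ : 0 ≤ Q) (hQP : Q ≤ P)
    (hη : η ≤ Q / 4) (hζ : ‖ζ‖ = 1) (hre : ζ.re ≤ 0) : ‖(P + Q * ζ : ℂ)‖ + η ≤ P + Q := by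
  have h1 : ‖(P + Q * ζ : ℂ)‖ ^ 2 ≤ (P + 3 / 4 * Q) ^ 2 := by
    have h2 : ζ.re * ζ.re + ζ.im * ζ.im = 1 := by
      rw [← Complex.normSq_apply, Complex.normSq_eq_norm_sq, hζ, one_pow]
    rw [← Complex.normSq_eq_norm_sq, Complex.normSq_apply]
    simp only [Complex.add_re, Complex.ofReal_re, Complex.mul_re, Complex.ofReal_im, zero_mul,
      sub_zero, Complex.add_im, Complex.mul_im, add_zero, zero_add]
    have h3 : P * Q * ζ.re ≤ 0 := mul_nonpos_of_nonneg_of_nonpos (mul_nonneg hP hQ) hre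
    have h4 : Q * Q ≤ P * Q := mul_le_mul_of_nonneg_right hQP hQ
    have h5 : Q ^ 2 * (ζ.re * ζ.re + ζ.im * ζ.im) = Q ^ 2 := by rw [h2, mul_one]
    nlinarith
  have h6 := (abs_le.mp (abs_le_of_sq_le_sq h1 (by positivity))).2
  linarith

/-- Each of the functionals `g` dominates the others near some point. -/
theorem exists_peak (hε : 0 < ε) (hε' : ε ≤ 1 / 8) (a : A) (k : Fin 3) :
    ∃ (x₀ : W) (η : ℝ), 0 < η ∧ ‖x₀‖ + η ≤ ‖D.g ε (a, k) x₀‖ ∧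
      (∀ p, (∀ y, ‖D.g ε p y‖ = ‖D.g ε (a, k) y‖) ∨
        ‖D.g ε p x₀‖ + η ≤ ‖D.g ε (a, k) x₀‖) ∧
      ∀ s : W →L[ℂ] ℂ, ‖s‖ ≤ 2 → s (D.x a) = 0 → ‖s x₀‖ + η ≤ ‖D.g ε (a, k) x₀‖ := by
  have other (b : A) (l : Fin 3) (hb : b ≠ a) : ‖D.g ε (b, l) (D.x a)‖ ≤ ε := by
    rw [g_apply, D.f_ne b a hb, mul_zero, zero_add, norm_mul, norm_mul, norm_phase,
      Complex.norm_real, Real.norm_of_nonneg hε.le, mul_one]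
    have : ‖D.h b (D.x a)‖ ≤ 1 :=
      ((D.h b).le_of_opNorm_le (D.norm_h b) _).trans (by simpa using D.norm_x a)
    nlinarith
  -- When `h a` vanishes the three faces coincide and `x a` itself is a peak. Otherwise `x a` is
  -- moved slightly in a direction seen by `h a` but not by `f a`.
  by_cases h0 : D.h a = 0
  · have hval : ‖D.g ε (a, k) (D.x a)‖ = 1 + ε := by
      rw [g_apply, h0, D.f_self, ← Complex.ofReal_one, ← Complex.ofReal_add]
      simp only [Complex.ofReal_one, mul_one, zero_apply, mul_zero, add_zero]
      rw [Complex.norm_real, Real.norm_of_nonneg]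
      linarith
    refine ⟨D.x a, ε, hε, by linarith [D.norm_x a], fun ⟨b, l⟩ => ?_, fun s _ hs => ?_⟩
    · by_cases hb : b = a
      · subst hb
        left
        intro y
        rw [g_apply, g_apply, h0]
        simp
      · right
        linarith [other b l hb]
    · rw [hs, norm_zero]
      linarith
  · obtain ⟨z₀, hz₀⟩ : ∃ z, D.h a z ≠ 0 := by
      by_contra! hcon
      exact h0 (by ext z; simpa using hcon z)
    obtain ⟨z, hz, hfz⟩ : ∃ z, D.h a z = 1 ∧ D.f a z = 0 := by
      refine ⟨(D.h a z₀)⁻¹ • (z₀ - D.f a z₀ • D.x a), ?_, ?_⟩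
      · simp [D.h_x, hz₀]
      · simp [D.f_self]
    obtain ⟨t, ht0, ht1, htz⟩ : ∃ t : ℝ, 0 < t ∧ t ≤ 1 ∧ t * ‖z‖ ≤ ε / 8 := by
      refine ⟨min 1 (ε / 8 / (‖z‖ + 1)), by positivity, min_le_left _ _, ?_⟩
      calc min 1 (ε / 8 / (‖z‖ + 1)) * ‖z‖ ≤ ε / 8 / (‖z‖ + 1) * (‖z‖ + 1) := by
            gcongr
            · exact min_le_right _ _
            · linarith
        _ = ε / 8 := by field_simp
    -- The conjugate phase aligns the face of index k, raising its value to 1 + ε + εt, while the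
    -- norm grows by at most ε/8.
    set w : W := ((t : ℂ) * (starRingEnd ℂ) (phase k)) • z with hw
    have hwn : ‖w‖ ≤ ε / 8 := by
      rw [hw, norm_smul, norm_mul, Complex.norm_conj, norm_phase, mul_one, Complex.norm_real,
        Real.norm_of_nonneg ht0.le]
      exact htz
    have hsame (l : Fin 3) : D.g ε (a, l) (D.x a + w) =
        ((1 + ε : ℝ) : ℂ) + ((ε * t : ℝ) : ℂ) * (phase l * (starRingEnd ℂ) (phase k)) := by
      rw [g_apply, map_add, map_add, D.f_self, D.h_x, hw, map_smul, map_smul, hz, hfz]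
      push_cast
      simp only [smul_eq_mul]
      ring
    have hval : ‖D.g ε (a, k) (D.x a + w)‖ = 1 + ε + ε * t := by
      rw [hsame, phase_mul_conj_self, mul_one, ← Complex.ofReal_add, Complex.norm_real,
        Real.norm_of_nonneg (by positivity)]
    have hεt : 0 < ε * t := by positivity
    have hεt' : ε * t ≤ ε := mul_le_of_le_one_right hε.le ht1
    refine ⟨D.x a + w, ε * t / 4, by positivity, ?_, fun ⟨b, l⟩ => ?_, fun s hs hsx => ?_⟩
    · rw [hval]
      linarith [norm_add_le (D.x a) w, D.norm_x a]
    · by_cases hb : b = a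
      · subst hb
        by_cases hl : l = k
        · subst hl
          exact Or.inl fun y => rfl
        · right
          rw [hval, hsame]
          refine norm_add_mul_le (by linarith) hεt.le (by linarith) le_rfl ?_
            (phase_mul_conj_re hl)
          rw [norm_mul, Complex.norm_conj, norm_phase, norm_phase, mul_one]
      · right
        rw [hval, map_add]
        have h1 : ‖D.g ε (b, l) w‖ ≤ (1 + 2 * ε) * (ε / 8) :=
          ((D.g ε (b, l)).le_of_opNorm_le (D.norm_g hε _) w).trans (by gcongr)
        nlinarith [norm_add_le (D.g ε (b, l) (D.x a)) (D.g ε (b, l) w), other b l hb]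
    · rw [hval, map_add, hsx, zero_add]
      have h1 : ‖s w‖ ≤ 2 * (ε / 8) := (s.le_of_opNorm_le hs w).trans (by gcongr)
      linarith

section Family

variable {S : Type*} (s : S → W →L[ℂ] ℂ)

/-- The full family of functionals: special ones `s` and the faces `g`. -/
noncomputable def family (ε : ℝ) : S ⊕ (A × Fin 3) → W →L[ℂ] ℂ := Sum.elim s (D.g ε)

theorem norm_family (hε : 0 < ε) (hε' : ε ≤ 1 / 8) (hs : ∀ j, ‖s j‖ ≤ 2) (i) :
    ‖D.family s ε i‖ ≤ 2 := by
  rcases i with j | p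
  · exact hs j
  · exact (D.norm_g hε p).trans (by linarith)

variable {s} {J : W →ₗ[ℝ] W}

/-- Special functionals vanish at the vectors `x a`, hence stay small at the nearby peaks and do not
interfere with the faces. -/
theorem g_mem_eigenDual_or (hε : 0 < ε) (hε' : ε ≤ 1 / 8) (hs : ∀ j, ‖s j‖ ≤ 2)
    (hsx : ∀ j a, s j (D.x a) = 0)
    (hq : ∀ (a b : ℝ) (x : W), supNorm (D.family s ε) (a • x + b • J x) =
      ‖(⟨a, b⟩ : ℂ)‖ * supNorm (D.family s ε) x) (p : A × Fin 3) :
    D.g ε p ∈ eigenDual J Complex.I ∨ D.g ε p ∈ eigenDual J (-Complex.I) := by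
  obtain ⟨a, k⟩ := p
  obtain ⟨x₀, η, hη, h1, h2, h3⟩ := D.exists_peak hε hε' a k
  refine mem_eigenDual_or_of_eventually hq (F := D.g ε (a, k)) (x₀ := x₀)
    (eventually_supNorm_eq (i := Sum.inr (a, k)) (D.norm_family s hε hε' hs) hη h1 fun j => ?_)
  rcases j with j | p
  · exact Or.inr (h3 (s j) (hs j) (hsx j a))
  · exact h2 p

theorem g_ne_zero (hε : 0 < ε) (a : A) (k : Fin 3) : D.g ε (a, k) ≠ 0 := fun h0 => by
  have h1 := D.g_apply ε a k (D.x a)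
  rw [h0, D.f_self, D.h_x] at h1
  have h2 : ((1 + ε : ℝ) : ℂ) = 0 := by
    push_cast
    simpa using h1.symm
  have h3 : 1 + ε = 0 := by exact_mod_cast h2
  linarith

/-- A complex structure which is isometric for the new norm acts on each `f` and on the attached
functional with the same sign. -/
theorem exists_sign (hε : 0 < ε) (hε' : ε ≤ 1 / 8) (hs : ∀ j, ‖s j‖ ≤ 2)
    (hsx : ∀ j a, s j (D.x a) = 0)
    (hq : ∀ (a b : ℝ) (x : W), supNorm (D.family s ε) (a • x + b • J x) =
      ‖(⟨a, b⟩ : ℂ)‖ * supNorm (D.family s ε) x) (a : A) :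
    (D.f a ∈ eigenDual J Complex.I ∧ D.u a + D.c a • D.σ ∈ eigenDual J Complex.I) ∨
      (D.f a ∈ eigenDual J (-Complex.I) ∧ D.u a + D.c a • D.σ ∈ eigenDual J (-Complex.I)) := by
  have hg := fun k => D.g_mem_eigenDual_or hε hε' hs hsx hq (a, k)
  have hεC : (ε : ℂ) ≠ 0 := by exact_mod_cast hε.ne'
  have hεC' : (1 + ε : ℂ) ≠ 0 := by
    have : (1 + ε : ℝ) ≠ 0 := by linarith
    exact_mod_cast this
  -- The phase 1 is an affine combination of i and -i with nonzero coefficients; the third face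
  -- exists to tie the signs of the first two.
  have hcomb : ((1 - Complex.I) / 2 : ℂ) • D.g ε (a, 0) + ((1 + Complex.I) / 2 : ℂ) • D.g ε (a, 1) =
      D.g ε (a, 2) := by
    ext y
    simp only [add_apply, smul_apply, smul_eq_mul,
      g_apply, phase, Matrix.cons_val_zero, Matrix.cons_val_one, Matrix.cons_val]
    linear_combination (-ε * D.h a y) * Complex.I_sq
  have hI1 : ((1 + Complex.I) / 2 : ℂ) ≠ 0 := fun h0 => by
    have := congrArg Complex.re h0
    norm_num at this
  have hI2 : ((1 - Complex.I) / 2 : ℂ) ≠ 0 := fun h0 => by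
    have := congrArg Complex.re h0
    norm_num at this
  have main {c : ℂ} (h0 : D.g ε (a, 0) ∈ eigenDual J c) (h1 : D.g ε (a, 1) ∈ eigenDual J c) :
      D.f a ∈ eigenDual J c ∧ D.u a + D.c a • D.σ ∈ eigenDual J c := by
    have hf : D.f a ∈ eigenDual J c := by
      have e : D.f a = (2 * (1 + ε) : ℂ)⁻¹ • (D.g ε (a, 0) + D.g ε (a, 1)) := by
        ext y
        simp only [add_apply, smul_apply, smul_eq_mul,
          g_apply, phase, Matrix.cons_val_zero, Matrix.cons_val_one]
        field_simp
        ring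
      rw [e]
      exact Submodule.smul_mem _ _ (Submodule.add_mem _ h0 h1)
    have hh : D.h a ∈ eigenDual J c := by
      have e : D.h a = (2 * ε * Complex.I : ℂ)⁻¹ • (D.g ε (a, 0) - D.g ε (a, 1)) := by
        ext y
        simp only [sub_apply, smul_apply, smul_eq_mul,
          g_apply, phase, Matrix.cons_val_zero, Matrix.cons_val_one]
        field_simp
        ring
      rw [e]
      exact Submodule.smul_mem _ _ (Submodule.sub_mem _ h0 h1)
    refine ⟨hf, ?_⟩
    have e : D.u a + D.c a • D.σ = (4 : ℂ) • D.h a + D.u a (D.x a) • D.f a := by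
      rw [h, smul_smul]
      norm_num
    rw [e]
    exact Submodule.add_mem _ (Submodule.smul_mem _ _ hh) (Submodule.smul_mem _ _ hf)
  rcases mem_eigenDual_and_of_combination hI2 hI1 (D.g_ne_zero hε a 0) (D.g_ne_zero hε a 1)
    (hg 0) (hg 1) (by rw [hcomb]; exact hg 2) with h1 | h1
  · exact Or.inl (main h1.1 h1.2)
  · exact Or.inr (main h1.1 h1.2)

/-- A functional `k` is linked to `σ` if both `k` and `k + σ` occur in the system, up to multiples
of the functionals `f`. -/
def Linked (k : W →L[ℂ] ℂ) : Prop :=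
  (∃ a, k = D.f a ∧ D.u a = 0 ∧ D.c a = 1) ∨
    ((∃ a, D.u a = k ∧ D.c a = 0) ∧ ∃ a, D.u a = k ∧ D.c a = 1)

/-- Either σ is itself attached to the index of k = `f a`, or k and k + σ each have a sign; then a
sign of σ makes `mem_eigenDual_and_of_combination` applicable to k, σ and their sum. -/
theorem Linked.mem_eigenDual (hε : 0 < ε) (hε' : ε ≤ 1 / 8) (hs : ∀ j, ‖s j‖ ≤ 2)
    (hsx : ∀ j a, s j (D.x a) = 0)
    (hq : ∀ (a b : ℝ) (x : W), supNorm (D.family s ε) (a • x + b • J x) =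
      ‖(⟨a, b⟩ : ℂ)‖ * supNorm (D.family s ε) x)
    (hσ0 : D.σ ≠ 0) {k : W →L[ℂ] ℂ} (hk : D.Linked k) :
    (D.σ ∈ eigenDual J Complex.I → k ∈ eigenDual J Complex.I) ∧
      (D.σ ∈ eigenDual J (-Complex.I) → k ∈ eigenDual J (-Complex.I)) := by
  have sgn := D.exists_sign hε hε' hs hsx hq
  have no : ¬(D.σ ∈ eigenDual J Complex.I ∧ D.σ ∈ eigenDual J (-Complex.I)) := fun h =>
    hσ0 (eq_zero_of_mem_eigenDual h.1 h.2)
  rcases hk with ⟨a, hf, hu, hc⟩ | ⟨⟨a, hu, hc⟩, b, hu', hc'⟩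
  · have := sgn a
    have e : D.u a + D.c a • D.σ = D.σ := by
      ext y
      simp [hu, hc]
    rw [e, ← hf] at this
    tauto
  · have h1 := sgn a
    have h2 := sgn b
    have e : D.u a + D.c a • D.σ = k := by
      ext y
      simp [hu, hc]
    have e' : D.u b + D.c b • D.σ = k + D.σ := by
      ext y
      simp [hu', hc']
    rw [e] at h1
    rw [e'] at h2
    by_cases hk0 : k = 0
    · subst hk0
      exact ⟨fun _ => Submodule.zero_mem _, fun _ => Submodule.zero_mem _⟩
    · have key (hσ : D.σ ∈ eigenDual J Complex.I ∨ D.σ ∈ eigenDual J (-Complex.I)) :=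
        mem_eigenDual_and_of_combination (J := J) (c := 1) (d := 1) one_ne_zero one_ne_zero hk0 hσ0
          (by tauto) hσ (by rw [one_smul, one_smul]; tauto)
      tauto

end Family

end PeakData

/-! ### Existence of linked systems. -/

/-- A bounded biorthogonal system, together with functionals `u` carrying a mark `c`, such that the
functionals which can be linked through these data separate points. -/
structure LinkedSystem (𝕜 : Type*) [RCLike 𝕜] (Y : Type*) [NormedAddCommGroup Y] [NormedSpace 𝕜 Y]
    (A : Type*) (C : ℝ) where
  x : A → Y
  f : A → Y →L[𝕜] 𝕜
  u : A → Y →L[𝕜] 𝕜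
  c : A → Bool
  norm_x : ∀ a, ‖x a‖ = 1
  norm_f : ∀ a, ‖f a‖ ≤ C
  norm_u : ∀ a, ‖u a‖ ≤ 1
  f_self : ∀ a, f a (x a) = 1
  f_ne : ∀ a b, a ≠ b → f a (x b) = 0
  total : ∀ y, (∀ k : Y →L[𝕜] 𝕜, (∃ a, k = f a ∧ u a = 0 ∧ c a = true) ∨
    ((∃ a, u a = k ∧ c a = false) ∧ ∃ a, u a = k ∧ c a = true) → k y = 0) → y = 0

section Existence

variable {𝕜 : Type*} [RCLike 𝕜] {Y : Type u} [NormedAddCommGroup Y] [NormedSpace 𝕜 Y]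

/-- The coordinate functionals already separate points, so nothing but the mark needs to be
attached. This case is separate because a finite index set leaves no room for encoding both marks of
a total set. -/
theorem exists_linkedSystem_of_finiteDimensional [FiniteDimensional 𝕜 Y] :
    ∃ (A : Type u) (C : ℝ), Nonempty (LinkedSystem 𝕜 Y A C) := by
  classical
  let b := Module.Free.chooseBasis 𝕜 Y
  let f : Module.Free.ChooseBasisIndex 𝕜 Y → Y →L[𝕜] 𝕜 := fun i =>
    (‖b i‖ : 𝕜) • LinearMap.toContinuousLinearMap (b.coord i)
  have hb : ∀ i, (‖b i‖ : 𝕜) ≠ 0 := fun i => by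
    rw [Ne, RCLike.ofReal_eq_zero, norm_eq_zero]
    exact b.ne_zero i
  refine ⟨Module.Free.ChooseBasisIndex 𝕜 Y, ∑ i, ‖f i‖,
    ⟨{ x := fun i => (‖b i‖ : 𝕜)⁻¹ • b i, f := f, u := fun _ => 0, c := fun _ => true,
       norm_x := ?_, norm_f := ?_, norm_u := ?_, f_self := ?_, f_ne := ?_, total := ?_ }⟩⟩
  · intro i
    rw [norm_smul, norm_inv, RCLike.norm_ofReal, abs_norm,
      inv_mul_cancel₀ (norm_ne_zero_iff.mpr (b.ne_zero i))]
  · intro i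
    exact Finset.single_le_sum (f := fun i => ‖f i‖) (fun i _ => norm_nonneg _) (Finset.mem_univ i)
  · intro i
    simp
  · intro i
    simp [f, hb i]
  · intro i j hij
    simp [f, hij.symm]
  · intro y hy
    refine b.forall_coord_eq_zero_iff.mp fun i => ?_
    have := hy (f i) (Or.inl ⟨i, rfl, rfl, rfl⟩)
    simpa [f, hb i] using this

/-- Finitely many functionals of norm at most one norm a finite-dimensional subspace up to a factor
of two. -/
theorem exists_finite_norming (V : Submodule 𝕜 Y) [FiniteDimensional 𝕜 V] :
    ∃ K : Set (Y →L[𝕜] 𝕜), K.Finite ∧ (∀ k ∈ K, ‖k‖ ≤ 1) ∧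
      ∀ v ∈ V, v ≠ 0 → ∃ k ∈ K, ‖v‖ ≤ 2 * ‖k v‖ := by
  have := FiniteDimensional.proper_rclike 𝕜 V
  have hc : IsCompact (((↑) : V → Y) '' Metric.sphere (0 : V) 1) :=
    (isCompact_sphere (0 : V) 1).image continuous_subtype_val
  -- Functionals norming a 1/2-net of the unit sphere take modulus at least 1/2 at every unit vector
  -- for some member.
  obtain ⟨t, ht, htf, hcover⟩ := hc.finite_cover_balls (e := 1 / 2) (by norm_num)
  choose φ hφ1 hφ2 using fun y : Y => exists_dual_vector'' 𝕜 y
  refine ⟨φ '' t, htf.image _, ?_, fun v hv hv0 => ?_⟩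
  · rintro _ ⟨y, -, rfl⟩
    exact hφ1 y
  · have hvn : ‖v‖ ≠ 0 := norm_ne_zero_iff.mpr hv0
    have hw : (‖v‖ : 𝕜)⁻¹ • v ∈ ((↑) : V → Y) '' Metric.sphere (0 : V) 1 := by
      refine ⟨⟨(‖v‖ : 𝕜)⁻¹ • v, V.smul_mem _ hv⟩, ?_, rfl⟩
      rw [mem_sphere_zero_iff_norm, Submodule.coe_norm, norm_smul, norm_inv, RCLike.norm_ofReal,
        abs_norm, inv_mul_cancel₀ hvn]
    obtain ⟨y, hy, hball⟩ := Set.mem_iUnion₂.mp (hcover hw)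
    refine ⟨φ y, ⟨y, hy, rfl⟩, ?_⟩
    obtain ⟨y', hy', hyy⟩ := ht hy
    have hyn : ‖y‖ = 1 := by
      rw [← hyy, ← Submodule.coe_norm]
      exact mem_sphere_zero_iff_norm.mp hy'
    rw [mem_ball_iff_norm] at hball
    have h1 : ‖φ y ((‖v‖ : 𝕜)⁻¹ • v - y)‖ ≤ 1 / 2 :=
      ((φ y).le_of_opNorm_le (hφ1 y) _).trans (by linarith)
    have h2 : ‖φ y y‖ = 1 := by
      rw [hφ2, RCLike.norm_ofReal, abs_norm, hyn]
    rw [map_sub] at h1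
    have h3 : 1 / 2 ≤ ‖φ y ((‖v‖ : 𝕜)⁻¹ • v)‖ := by
      have := norm_sub_norm_le (φ y y) (φ y ((‖v‖ : 𝕜)⁻¹ • v))
      rw [norm_sub_rev] at this
      linarith
    rw [map_smul, norm_smul, norm_inv, RCLike.norm_ofReal, abs_norm, inv_mul_eq_div,
      le_div_iff₀ (by positivity)] at h3
    linarith

/-- A vector at a distance from a subspace can be separated from it by a bounded functional. -/
theorem exists_dual_separating {V : Submodule 𝕜 Y} {x : Y} {c : ℝ} (hc : 0 < c)
    (hx : ∀ v ∈ V, 1 ≤ c * ‖x + v‖) :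
    ∃ f : Y →L[𝕜] 𝕜, f x = 1 ∧ (∀ v ∈ V, f v = 0) ∧ ‖f‖ ≤ c := by
  have hq : 1 ≤ c * ‖V.mkQ x‖ := by
    refine le_of_forall_pos_le_add fun e he => ?_
    obtain ⟨m, hm, hlt⟩ := Submodule.Quotient.norm_mk_lt (V.mkQ x) (div_pos he hc)
    have hmem : m - x ∈ V := by
      rw [← Submodule.Quotient.eq]
      exact hm
    have h1 := hx _ hmem
    rw [add_sub_cancel] at h1
    refine h1.trans ((mul_le_mul_of_nonneg_left hlt.le hc.le).trans ?_)
    rw [mul_add, mul_div_cancel₀ _ hc.ne']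
  have hpos : 0 < ‖V.mkQ x‖ := by
    by_contra h0
    have : ‖V.mkQ x‖ = 0 := le_antisymm (not_lt.mp h0) (norm_nonneg _)
    rw [this] at hq
    linarith
  -- Hahn–Banach is applied in the quotient, which is only seminormed as V need not be closed; the
  -- class of x has seminorm at least 1/c.
  obtain ⟨g, hg1, hg2⟩ := exists_dual_vector 𝕜 (V.mkQ x) hpos.ne'
  let π : Y →L[𝕜] Y ⧸ V := V.mkQ.mkContinuous 1 fun y => by
    rw [one_mul]
    exact Submodule.Quotient.norm_mk_le V y
  have hπ : ‖π‖ ≤ 1 := LinearMap.mkContinuous_norm_le _ zero_le_one _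
  refine ⟨(‖V.mkQ x‖ : 𝕜)⁻¹ • g.comp π, ?_, fun v hv => ?_, ?_⟩
  · change (‖V.mkQ x‖ : 𝕜)⁻¹ * g (V.mkQ x) = 1
    rw [hg2, inv_mul_cancel₀]
    exact_mod_cast hpos.ne'
  · change (‖V.mkQ x‖ : 𝕜)⁻¹ * g (V.mkQ v) = 0
    have h0 : V.mkQ v = 0 := (Submodule.Quotient.mk_eq_zero V).mpr hv
    rw [h0, map_zero, mul_zero]
  · rw [norm_smul, norm_inv, RCLike.norm_ofReal, abs_norm]
    have h1 : ‖g.comp π‖ ≤ 1 := (g.opNorm_comp_le π).trans (by rw [hg1, one_mul]; exact hπ)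
    calc ‖V.mkQ x‖⁻¹ * ‖g.comp π‖ ≤ ‖V.mkQ x‖⁻¹ * 1 := by gcongr
      _ ≤ c := by
        rw [mul_one, inv_le_iff_one_le_mul₀ hpos]
        exact hq

/-- The property of a set of vectors and functionals of being a bounded biorthogonal system. -/
def IsBiorthogonal (P : Set (Y × (Y →L[𝕜] 𝕜))) : Prop :=
  (∀ p ∈ P, ‖p.1‖ = 1 ∧ p.2 p.1 = 1 ∧ ‖p.2‖ ≤ 3) ∧ ∀ p ∈ P, ∀ r ∈ P, p ≠ r → p.2 r.1 = 0

/-- Zorn's lemma: the defining condition involves at most two pairs at a time, so it passes to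
unions of chains. -/
theorem exists_maximal_isBiorthogonal :
    ∃ P : Set (Y × (Y →L[𝕜] 𝕜)), Maximal (fun P => P ∈ {P | IsBiorthogonal P}) P := by
  refine zorn_subset _ fun c hc hchain => ⟨⋃₀ c, ⟨?_, ?_⟩, fun s hs => Set.subset_sUnion_of_mem hs⟩
  · rintro p ⟨s, hs, hps⟩
    exact (hc hs).1 p hps
  · rintro p ⟨s, hs, hps⟩ r ⟨t, ht, hrt⟩ hpr
    rcases hchain.total hs ht with h | h
    · exact (hc ht).2 p (h hps) r hrt hpr
    · exact (hc hs).2 p hps r (h hrt) hpr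

/-- A unit vector x killed by all the functionals is at distance at least 1/3 from the span: if k
norms v up to a factor 2 and k x = 0, then ‖x + v‖ ≥ ‖v‖/2 ≥ (1 - ‖x + v‖)/2. A functional of norm
at most 3 then completes x to a new pair, contradicting maximality; this is the origin of the bound
3. -/
theorem exists_total_of_maximal {P : Set (Y × (Y →L[𝕜] 𝕜))}
    (hP : Maximal (fun P => P ∈ {P | IsBiorthogonal P}) P) (K : Finset P → Set (Y →L[𝕜] 𝕜))
    (hK1 : ∀ s, ∀ k ∈ K s, ‖k‖ ≤ 1)
    (hK : ∀ s : Finset P, ∀ v ∈ Submodule.span 𝕜 ((fun p : P => p.1.1) '' (s : Set P)), v ≠ 0 →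
      ∃ k ∈ K s, ‖v‖ ≤ 2 * ‖k v‖) {y : Y} (hy : ∀ p ∈ P, p.2 y = 0)
    (hyK : ∀ s, ∀ k ∈ K s, k y = 0) : y = 0 := by
  classical
  by_contra hy0
  have hyn : ‖y‖ ≠ 0 := norm_ne_zero_iff.mpr hy0
  set x : Y := (‖y‖ : 𝕜)⁻¹ • y with hx
  have hxn : ‖x‖ = 1 := by
    rw [hx, norm_smul, norm_inv, RCLike.norm_ofReal, abs_norm, inv_mul_cancel₀ hyn]
  have hxP : ∀ p ∈ P, p.2 x = 0 := fun p hp => by rw [hx, map_smul, hy p hp, smul_zero]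
  have hxK : ∀ s, ∀ k ∈ K s, k x = 0 := fun s k hk => by rw [hx, map_smul, hyK s k hk, smul_zero]
  set V := Submodule.span 𝕜 (Set.range fun p : P => p.1.1) with hV
  have dist : ∀ v ∈ V, 1 ≤ 3 * ‖x + v‖ := by
    intro v hv
    by_cases hv0 : v = 0
    · rw [hv0, add_zero, hxn]
      norm_num
    · obtain ⟨t, ht, hvt⟩ := Submodule.mem_span_finite_of_mem_span hv
      obtain ⟨s, hs⟩ : ∃ s : Finset P, (t : Set Y) ⊆ (fun p : P => p.1.1) '' (s : Set P) := by
        choose g hg using fun z : t => ht z.2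
        refine ⟨Finset.univ.image g, fun z hz => ⟨g ⟨z, hz⟩, ?_, hg ⟨z, hz⟩⟩⟩
        simp
      obtain ⟨k, hk, hkv⟩ := hK s v (Submodule.span_mono hs hvt) hv0
      have h1 : ‖k (x + v)‖ ≤ 1 * ‖x + v‖ := k.le_of_opNorm_le (hK1 s k hk) _
      rw [map_add, hxK s k hk, zero_add, one_mul] at h1
      have h2 := norm_sub_norm_le x (-v)
      rw [norm_neg, sub_neg_eq_add, hxn] at h2
      linarith
  obtain ⟨f, hfx, hfV, hfn⟩ := exists_dual_separating (by norm_num) dist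
  have hnew : IsBiorthogonal (insert (x, f) P) := by
    constructor
    · rintro p (rfl | hp)
      · exact ⟨hxn, hfx, hfn⟩
      · exact hP.1.1 p hp
    · rintro p (rfl | hp) r (rfl | hr) hpr
      · exact absurd rfl hpr
      · exact hfV _ (Submodule.subset_span ⟨⟨r, hr⟩, rfl⟩)
      · exact hxP p hp
      · exact hP.1.2 p hp r hr hpr
  have hmem : (x, f) ∈ P := hP.2 hnew (Set.subset_insert _ _) (Set.mem_insert _ _)
  have := hxP _ hmem
  rw [hfx] at this
  exact one_ne_zero this

/-- In infinite dimension the total set of `exists_total_of_maximal` has no more elements than the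
maximal system P, even counted with two marks. A surjection from P then attaches every member of it
with both marks. -/
theorem exists_linkedSystem {𝕜 : Type} [RCLike 𝕜] (Y : Type u) [NormedAddCommGroup Y]
    [NormedSpace 𝕜 Y] : ∃ (A : Type u) (C : ℝ), Nonempty (LinkedSystem 𝕜 Y A C) := by
  classical
  by_cases hfin : FiniteDimensional 𝕜 Y
  · exact exists_linkedSystem_of_finiteDimensional
  obtain ⟨P, hP⟩ := exists_maximal_isBiorthogonal (𝕜 := 𝕜) (Y := Y)
  have hK (s : Finset P) := by
    have : FiniteDimensional 𝕜 (Submodule.span 𝕜 ((fun p : P => p.1.1) '' (s : Set P))) :=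
      FiniteDimensional.span_of_finite 𝕜 (s.finite_toSet.image _)
    exact exists_finite_norming (Submodule.span 𝕜 ((fun p : P => p.1.1) '' (s : Set P)))
  choose K hKf hK1 hK using hK
  set T : Set (Y →L[𝕜] 𝕜) := Set.range (fun p : P => (3⁻¹ : 𝕜) • p.1.2) ∪ ⋃ s, K s with hT
  have hTn : ∀ k ∈ T, ‖k‖ ≤ 1 := by
    rintro k (⟨p, rfl⟩ | hk)
    · rw [norm_smul, norm_inv, RCLike.norm_ofNat]
      have := (hP.1.1 p p.2).2.2
      linarith
    · obtain ⟨s, hs⟩ := Set.mem_iUnion.mp hk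
      exact hK1 s k hs
  have hTt : ∀ y : Y, (∀ k ∈ T, k y = 0) → y = 0 := by
    intro y hy
    refine exists_total_of_maximal hP K hK1 hK (fun p hp => ?_) fun s k hk =>
      hy k (Or.inr (Set.mem_iUnion_of_mem s hk))
    simpa using hy _ (Or.inl ⟨⟨p, hp⟩, rfl⟩)
  -- A finite P would make T a finite total set, embedding Y in a finite-dimensional space.
  have hinf : Infinite P := by
    by_contra hcon
    have : Finite P := not_infinite_iff_finite.mp hcon
    have hTfin : T.Finite := (Set.finite_range _).union (Set.finite_iUnion hKf)
    have : Finite T := hTfin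
    refine hfin (Module.Finite.of_injective
      (LinearMap.pi fun k : T => (k.1 : Y →ₗ[𝕜] 𝕜)) ?_)
    rw [← LinearMap.ker_eq_bot, LinearMap.ker_eq_bot']
    intro y hy
    exact hTt y fun k hk => congrFun hy ⟨k, hk⟩
  have hcard : Cardinal.mk (T × Bool) ≤ Cardinal.mk P := by
    have hPinf := Cardinal.aleph0_le_mk P
    have h1 : Cardinal.mk (⋃ s, K s) ≤ Cardinal.mk P := by
      refine (Cardinal.mk_iUnion_le K).trans ?_
      rw [Cardinal.mk_finset_of_infinite]
      refine Cardinal.mul_le_of_le hPinf le_rfl (ciSup_le' fun s => ?_)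
      exact ((Cardinal.lt_aleph0_iff_set_finite.mpr (hKf s)).le).trans hPinf
    have h2 : Cardinal.mk T ≤ Cardinal.mk P :=
      (Cardinal.mk_union_le _ _).trans
        (Cardinal.add_le_of_le hPinf Cardinal.mk_range_le h1)
    rw [Cardinal.mk_prod, Cardinal.lift_uzero]
    refine Cardinal.mul_le_of_le hPinf h2 ?_
    simpa using (Cardinal.natCast_lt_aleph0 (n := 2)).le.trans hPinf
  obtain ⟨e⟩ := (Cardinal.le_def _ _).mp hcard
  have hne : Nonempty (T × Bool) := by
    obtain ⟨p⟩ := hinf.nonempty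
    exact ⟨⟨_, Or.inl ⟨p, rfl⟩⟩, true⟩
  obtain ⟨g, hg⟩ : ∃ g : P → T × Bool, Function.Surjective g :=
    ⟨Function.invFun e, Function.invFun_surjective e.injective⟩
  refine ⟨P, 3, ⟨{
    x := fun p => p.1.1
    f := fun p => p.1.2
    u := fun p => (g p).1
    c := fun p => (g p).2
    norm_x := fun p => (hP.1.1 p p.2).1
    norm_f := fun p => (hP.1.1 p p.2).2.2
    norm_u := fun p => hTn _ (g p).1.2
    f_self := fun p => (hP.1.1 p p.2).2.1
    f_ne := fun p r hpr => hP.1.2 p p.2 r r.2 fun h => hpr (Subtype.ext h)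
    total := ?_ }⟩⟩
  refine fun y hy => hTt y fun k hk => hy k (Or.inr ⟨?_, ?_⟩)
  · obtain ⟨p, hp⟩ := hg (⟨k, hk⟩, false)
    exact ⟨p, by rw [hp], by rw [hp]⟩
  · obtain ⟨p, hp⟩ := hg (⟨k, hk⟩, true)
    exact ⟨p, by rw [hp], by rw [hp]⟩

end Existence

/-! ### Renorming so that the biorthogonal functionals have norm at most one, and rigidity. -/

namespace LinkedSystem

variable {𝕜 : Type*} [RCLike 𝕜] {Y : Type*} [NormedAddCommGroup Y] [NormedSpace 𝕜 Y] {A : Type*}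
  {C : ℝ}

/-- The space `Y` with an equivalent norm for which the functionals of a linked system have norm at
most one. -/
def Renormed (_L : LinkedSystem 𝕜 Y A C) : Type _ := Y

variable (L : LinkedSystem 𝕜 Y A C)

theorem bddAbove_f (y : Y) : BddAbove (Set.range fun a => ‖L.f a y‖) := by
  refine ⟨C * ‖y‖, ?_⟩
  rintro _ ⟨a, rfl⟩
  exact (L.f a).le_of_opNorm_le (L.norm_f a) y

instance : AddCommGroup L.Renormed := inferInstanceAs (AddCommGroup Y)

instance : Module 𝕜 L.Renormed := inferInstanceAs (Module 𝕜 Y)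

/-- The identity map onto the renormed space. -/
def toRenormed : Y ≃ₗ[𝕜] L.Renormed := LinearEquiv.refl 𝕜 Y

noncomputable instance : Norm L.Renormed :=
  ⟨fun y => max ‖L.toRenormed.symm y‖ (⨆ a, ‖L.f a (L.toRenormed.symm y)‖)⟩

theorem norm_renormed (y : L.Renormed) :
    ‖y‖ = max ‖L.toRenormed.symm y‖ (⨆ a, ‖L.f a (L.toRenormed.symm y)‖) := rfl

theorem norm_symm_le (y : L.Renormed) : ‖L.toRenormed.symm y‖ ≤ ‖y‖ := le_max_left _ _

theorem norm_f_symm_le (a : A) (y : L.Renormed) : ‖L.f a (L.toRenormed.symm y)‖ ≤ ‖y‖ :=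
  (le_ciSup (L.bddAbove_f _) a).trans (le_max_right _ _)

theorem norm_renormed_le {y : L.Renormed} {r : ℝ} (h : ‖L.toRenormed.symm y‖ ≤ r)
    (hf : ∀ a, ‖L.f a (L.toRenormed.symm y)‖ ≤ r) : ‖y‖ ≤ r :=
  max_le h (Real.iSup_le hf ((norm_nonneg _).trans h))

theorem renormed_core : NormedSpace.Core 𝕜 L.Renormed where
  norm_nonneg y := (norm_nonneg _).trans (L.norm_symm_le y)
  norm_smul r y := by
    simp only [norm_renormed, map_smul, norm_smul]
    rw [mul_max_of_nonneg _ _ (norm_nonneg r), Real.mul_iSup_of_nonneg (norm_nonneg r)]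
  norm_triangle y z := by
    refine L.norm_renormed_le ?_ fun a => ?_
    · rw [map_add]
      exact (norm_add_le _ _).trans (add_le_add (L.norm_symm_le y) (L.norm_symm_le z))
    · rw [map_add, map_add]
      exact (norm_add_le _ _).trans (add_le_add (L.norm_f_symm_le a y) (L.norm_f_symm_le a z))
  norm_eq_zero_iff y := by
    constructor
    · intro h
      have := L.norm_symm_le y
      rw [h] at this
      exact L.toRenormed.symm.map_eq_zero_iff.mp (norm_le_zero_iff.mp this)
    · rintro rfl
      simp [norm_renormed]

noncomputable instance : NormedAddCommGroup L.Renormed := NormedAddCommGroup.ofCore L.renormed_core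

noncomputable instance : NormedSpace 𝕜 L.Renormed := NormedSpace.ofCore L.renormed_core

/-- The identity map onto the renormed space, as an isomorphism. -/
noncomputable def toRenormedL : Y ≃L[𝕜] L.Renormed :=
  L.toRenormed.toContinuousLinearEquivOfBounds (max 1 C) 1
    (fun y => by
      refine L.norm_renormed_le ?_ fun a => ?_
      · rw [LinearEquiv.symm_apply_apply]
        exact le_mul_of_one_le_left (norm_nonneg _) (le_max_left _ _)
      · rw [LinearEquiv.symm_apply_apply]
        exact (L.f a).le_of_opNorm_le ((L.norm_f a).trans (le_max_right _ _)) y)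
    (fun y => by
      rw [one_mul]
      exact L.norm_symm_le y)

theorem norm_toRenormedL_symm_le (y : L.Renormed) : ‖L.toRenormedL.symm y‖ ≤ ‖y‖ :=
  L.norm_symm_le y

/-- The linked system on the renormed space. -/
noncomputable def renorm (hx : ∀ a b, ‖L.f a (L.x b)‖ ≤ 1) : LinkedSystem 𝕜 L.Renormed A 1 where
  x a := L.toRenormedL (L.x a)
  f a := (L.f a).comp (L.toRenormedL.symm : L.Renormed →L[𝕜] Y)
  u a := (L.u a).comp (L.toRenormedL.symm : L.Renormed →L[𝕜] Y)
  c := L.c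
  norm_x a := by
    refine le_antisymm (L.norm_renormed_le (L.norm_x a).le fun b => hx b a) ?_
    rw [← L.norm_x a]
    exact L.norm_symm_le (L.toRenormedL (L.x a))
  norm_f a := ContinuousLinearMap.opNorm_le_bound _ zero_le_one fun y => by
    rw [one_mul]
    exact L.norm_f_symm_le a y
  norm_u a := ContinuousLinearMap.opNorm_le_bound _ zero_le_one fun y =>
    ((L.u a).le_of_opNorm_le (L.norm_u a) _).trans
      (by rw [one_mul, one_mul]; exact L.norm_toRenormedL_symm_le y)
  f_self a := by simp [L.f_self]
  f_ne a b hab := by simp [L.f_ne a b hab]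
  total y hy := by
    rw [← L.toRenormedL.symm.map_eq_zero_iff]
    refine L.total _ fun k hk => ?_
    refine hy (k.comp (L.toRenormedL.symm : L.Renormed →L[𝕜] Y)) ?_
    rcases hk with ⟨a, hf, hu, hc⟩ | ⟨⟨a, hu, hc⟩, b, hu', hc'⟩
    · exact Or.inl ⟨a, by rw [hf], by rw [hu, ContinuousLinearMap.zero_comp], hc⟩
    · exact Or.inr ⟨⟨a, by rw [hu], hc⟩, b, by rw [hu'], hc'⟩

end LinkedSystem

/-- Every normed space is isomorphic to one which carries a linked system of functionals of norm at
most one. -/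
theorem exists_renormed_linkedSystem (𝕜 : Type) [RCLike 𝕜] (Y : Type u) [NormedAddCommGroup Y]
    [NormedSpace 𝕜 Y] :
    ∃ (Z : Type u) (_ : NormedAddCommGroup Z) (_ : NormedSpace 𝕜 Z) (A : Type u),
      Nonempty (Y ≃L[𝕜] Z) ∧ Nonempty (LinkedSystem 𝕜 Z A 1) := by
  obtain ⟨A, C, ⟨L⟩⟩ := exists_linkedSystem (𝕜 := 𝕜) Y
  refine ⟨L.Renormed, inferInstance, inferInstance, A, ⟨L.toRenormedL⟩, ⟨L.renorm fun a b => ?_⟩⟩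
  by_cases hab : a = b
  · rw [hab, L.f_self, norm_one]
  · rw [L.f_ne a b hab, norm_zero]
    exact zero_le_one

namespace LinkedSystem

variable {𝕜 : Type*} [RCLike 𝕜] {Z : Type*} [NormedAddCommGroup Z] [NormedSpace 𝕜 Z] {A : Type*}
  {W : Type*} [NormedAddCommGroup W] [NormedSpace ℂ W]

/-- The functionals linked through a linked system. -/
def IsLinked (L : LinkedSystem 𝕜 Z A 1) (k : Z →L[𝕜] 𝕜) : Prop :=
  (∃ a, k = L.f a ∧ L.u a = 0 ∧ L.c a = true) ∨
    ((∃ a, L.u a = k ∧ L.c a = false) ∧ ∃ a, L.u a = k ∧ L.c a = true)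

/-- Transport of a linked system to a complex space. -/
noncomputable def toPeakData (L : LinkedSystem 𝕜 Z A 1) (i : Z → W) (Λ : (Z →L[𝕜] 𝕜) → W →L[ℂ] ℂ)
    (σ : W →L[ℂ] ℂ) (hi : ∀ z, ‖i z‖ ≤ ‖z‖) (hΛ : ∀ φ, ‖Λ φ‖ ≤ ‖φ‖)
    (h0 : ∀ φ z, φ z = 0 → Λ φ (i z) = 0) (h1 : ∀ φ z, φ z = 1 → Λ φ (i z) = 1)
    (hσ : ‖σ‖ ≤ 1) (hσi : ∀ z, σ (i z) = 0) : PeakData W A where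
  x a := i (L.x a)
  f a := Λ (L.f a)
  u a := Λ (L.u a)
  c a := if L.c a then 1 else 0
  σ := σ
  norm_x a := (hi _).trans (L.norm_x a).le
  norm_f a := (hΛ _).trans (L.norm_f a)
  norm_u a := (hΛ _).trans (L.norm_u a)
  norm_c a := by split_ifs <;> simp
  norm_σ := hσ
  f_self a := h1 _ _ (L.f_self a)
  f_ne a b hab := h0 _ _ (L.f_ne a b hab)
  σ_x a := hσi _

/-- Rigidity: every complex structure which is isometric for the new norm is the given one or its
conjugate. -/
theorem eq_or_eq_neg (L : LinkedSystem 𝕜 Z A 1) {i : Z → W} {Λ : (Z →L[𝕜] 𝕜) → W →L[ℂ] ℂ}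
    {σ : W →L[ℂ] ℂ} (hi : ∀ z, ‖i z‖ ≤ ‖z‖) (hΛ : ∀ φ, ‖Λ φ‖ ≤ ‖φ‖)
    (h0 : ∀ φ z, φ z = 0 → Λ φ (i z) = 0) (h1 : ∀ φ z, φ z = 1 → Λ φ (i z) = 1)
    (hσ : ‖σ‖ ≤ 1) (hσi : ∀ z, σ (i z) = 0) (hσ0 : σ ≠ 0)
    {S : Type*} {s : S → W →L[ℂ] ℂ} (hs : ∀ j, ‖s j‖ ≤ 2) (hsi : ∀ j z, s j (i z) = 0)
    (htot : ∀ w, (∀ j, s j w = 0) → (∀ k, L.IsLinked k → Λ k w = 0) → w = 0)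
    {ε : ℝ} (hε : 0 < ε) (hε' : ε ≤ 1 / 8) {J : W →ₗ[ℝ] W}
    (hq : ∀ (a b : ℝ) (x : W),
      supNorm ((L.toPeakData i Λ σ hi hΛ h0 h1 hσ hσi).family s ε) (a • x + b • J x) =
      ‖(⟨a, b⟩ : ℂ)‖ * supNorm ((L.toPeakData i Λ σ hi hΛ h0 h1 hσ hσi).family s ε) x)
    (hsJ : (σ ∈ eigenDual J Complex.I ∧ ∀ j, s j ∈ eigenDual J Complex.I) ∨
      (σ ∈ eigenDual J (-Complex.I) ∧ ∀ j, s j ∈ eigenDual J (-Complex.I))) :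
    (∀ w, J w = Complex.I • w) ∨ ∀ w, J w = (-Complex.I) • w := by
  set D := L.toPeakData i Λ σ hi hΛ h0 h1 hσ hσi with hD
  -- Linearity of `Λ` is not assumed; the norm bound gives its value at zero.
  have hΛ0 : Λ 0 = 0 := norm_le_zero_iff.mp ((hΛ 0).trans_eq norm_zero)
  have hlink : ∀ k, L.IsLinked k → D.Linked (Λ k) := by
    rintro k (⟨a, hf, hu, hc⟩ | ⟨⟨a, hu, hc⟩, b, hu', hc'⟩)
    · refine Or.inl ⟨a, by rw [hf]; rfl, ?_, ?_⟩
      · change Λ (L.u a) = 0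
        rw [hu, hΛ0]
      · exact if_pos hc
    · refine Or.inr ⟨⟨a, ?_, ?_⟩, b, ?_, if_pos hc'⟩
      · change Λ (L.u a) = _
        rw [hu]
      · change (if L.c a then (1 : ℂ) else 0) = 0
        rw [hc]
        rfl
      · change Λ (L.u b) = _
        rw [hu']
  have hk := fun k hk =>
    PeakData.Linked.mem_eigenDual D hε hε' hs (fun j a => hsi j _) hq hσ0 (hlink k hk)
  -- Once all signs equal that of σ, the vector J w - c w is killed by a total family.
  have fin {c : ℂ} (h1 : ∀ j, s j ∈ eigenDual J c)
      (h2 : ∀ k, L.IsLinked k → Λ k ∈ eigenDual J c) (w : W) : J w = c • w := by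
    rw [← sub_eq_zero]
    refine htot _ (fun j => ?_) fun k hk => ?_
    · rw [map_sub, h1 j w, map_smul, smul_eq_mul, sub_self]
    · rw [map_sub, h2 k hk w, map_smul, smul_eq_mul, sub_self]
  rcases hsJ with h | h
  · exact Or.inl (fin h.2 fun k hkl => (hk k hkl).1 h.1)
  · exact Or.inr (fin h.2 fun k hkl => (hk k hkl).2 h.1)

end LinkedSystem

/-! ### Transfer of the norm and of rigidity to X. -/

section Transfer

variable {X : Type u} [NormedAddCommGroup X] [NormedSpace ℝ X]
  {W : Type*} [NormedAddCommGroup W] [NormedSpace ℂ W] {ι : Type*} {G : ι → W →L[ℂ] ℂ} {C : ℝ}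

/-- The equivalent norm on `X` obtained from the norm `supNorm G` on an isomorphic space. -/
noncomputable def supNormEquivalentNorm (e : X ≃L[ℝ] W) (hC : ∀ i, ‖G i‖ ≤ C) (h1 : 1 ≤ C) :
    EquivalentNorm X where
  toFun x := supNorm G (e x)
  map_zero' := by simp [supNorm]
  add_le' x y := by
    rw [map_add]
    exact supNorm_add_le hC _ _
  neg' x := by rw [map_neg, supNorm_neg]
  smul' r x := by rw [map_smul, supNorm_smul_real]
  exists_lower := by
    refine ⟨(‖(e.symm : W →L[ℝ] X)‖ + 1)⁻¹, by positivity, fun x => ?_⟩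
    rw [inv_mul_le_iff₀ (by positivity)]
    have h := (e.symm : W →L[ℝ] X).le_opNorm (e x)
    rw [ContinuousLinearEquiv.coe_coe, e.symm_apply_apply] at h
    refine h.trans ?_
    gcongr
    · linarith
    · exact norm_le_supNorm (e x)
  exists_upper := by
    refine ⟨C * (‖(e : X →L[ℝ] W)‖ + 1), by positivity, fun x => ?_⟩
    refine (supNorm_le_mul hC h1 (e x)).trans ?_
    rw [mul_assoc]
    gcongr
    refine ((e : X →L[ℝ] W).le_opNorm x).trans ?_
    gcongr
    linarith

variable (e : X ≃L[ℝ] W) (hC : ∀ i, ‖G i‖ ≤ C) (h1 : 1 ≤ C)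

/-- The isomorphism from the renormed space. -/
noncomputable def supNormEquiv : (supNormEquivalentNorm e hC h1).Space ≃ₗ[ℝ] W := e.toLinearEquiv

theorem norm_eq_supNorm (v : (supNormEquivalentNorm e hC h1).Space) :
    ‖v‖ = supNorm G (supNormEquiv e hC h1 v) := rfl

/-- Multiplication by `i`, as a real linear map. -/
noncomputable def mulILinear (W : Type*) [NormedAddCommGroup W] [NormedSpace ℂ W] : W →ₗ[ℝ] W where
  toFun w := Complex.I • w
  map_add' := smul_add _
  map_smul' _ _ := smul_comm _ _ _

@[simp]
theorem mulILinear_apply (w : W) : mulILinear W w = Complex.I • w := rfl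

/-- Conjugation of a real linear operator by the isomorphism from the renormed space. -/
noncomputable def supNormConj (J : W →ₗ[ℝ] W) :
    (supNormEquivalentNorm e hC h1).Space →ₗ[ℝ] (supNormEquivalentNorm e hC h1).Space :=
  (supNormEquiv e hC h1).symm.toLinearMap ∘ₗ J ∘ₗ (supNormEquiv e hC h1).toLinearMap

theorem supNormConj_apply (J : W →ₗ[ℝ] W) (v : (supNormEquivalentNorm e hC h1).Space) :
    supNormConj e hC h1 J v = (supNormEquiv e hC h1).symm (J (supNormEquiv e hC h1 v)) := rfl

theorem supNormConj_mulI_sq (v : (supNormEquivalentNorm e hC h1).Space) :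
    supNormConj e hC h1 (mulILinear W) (supNormConj e hC h1 (mulILinear W) v) = -v := by
  rw [supNormConj_apply, supNormConj_apply, LinearEquiv.apply_symm_apply,
    LinearEquiv.symm_apply_eq, map_neg]
  rw [mulILinear_apply, mulILinear_apply, smul_smul, Complex.I_mul_I, neg_one_smul]

theorem norm_supNormConj_mulI (a b : ℝ) (v : (supNormEquivalentNorm e hC h1).Space) :
    ‖a • v + b • supNormConj e hC h1 (mulILinear W) v‖ = ‖(⟨a, b⟩ : ℂ)‖ * ‖v‖ := by
  rw [norm_eq_supNorm, norm_eq_supNorm, ← supNorm_smul_complex, supNormConj_apply, map_add,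
    map_smul, map_smul, LinearEquiv.apply_symm_apply]
  congr 1
  rw [mulILinear_apply, ← Complex.coe_smul, ← Complex.coe_smul, smul_smul, ← add_smul]
  congr 1
  apply Complex.ext <;> simp

theorem eq_supNormConj_of_rigid
    (rigid : ∀ J : W →ₗ[ℝ] W,
      (∀ (a b : ℝ) (x : W), supNorm G (a • x + b • J x) = ‖(⟨a, b⟩ : ℂ)‖ * supNorm G x) →
      (∀ w, J w = Complex.I • w) ∨ ∀ w, J w = (-Complex.I) • w)
    (J : (supNormEquivalentNorm e hC h1).Space →ₗ[ℝ] (supNormEquivalentNorm e hC h1).Space)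
    (hJ : ∀ (a b : ℝ) (x : (supNormEquivalentNorm e hC h1).Space),
      ‖a • x + b • J x‖ = ‖(⟨a, b⟩ : ℂ)‖ * ‖x‖) :
    J = supNormConj e hC h1 (mulILinear W) ∨ J = -supNormConj e hC h1 (mulILinear W) := by
  have h := rigid ((supNormEquiv e hC h1).toLinearMap ∘ₗ J ∘ₗ
    (supNormEquiv e hC h1).symm.toLinearMap) fun a b x => by
      have := hJ a b ((supNormEquiv e hC h1).symm x)
      rw [norm_eq_supNorm, norm_eq_supNorm, LinearEquiv.apply_symm_apply, map_add, map_smul,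
        map_smul, LinearEquiv.apply_symm_apply] at this
      exact this
  refine h.imp (fun h => ?_) fun h => ?_
  · ext v
    rw [supNormConj_apply, LinearEquiv.eq_symm_apply]
    simpa using h (supNormEquiv e hC h1 v)
  · ext v
    rw [LinearMap.neg_apply, supNormConj_apply, ← map_neg, LinearEquiv.eq_symm_apply]
    have := h (supNormEquiv e hC h1 v)
    rw [neg_smul] at this
    simpa [mulILinear] using this

theorem card_eq_one_of_rigid
    (rigid : ∀ J : W →ₗ[ℝ] W,
      (∀ (a b : ℝ) (x : W), supNorm G (a • x + b • J x) = ‖(⟨a, b⟩ : ℂ)‖ * supNorm G x) →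
      (∀ w, J w = Complex.I • w) ∨ ∀ w, J w = (-Complex.I) • w)
    (T : W ≃ₗ[ℝ] W) (hT : ∀ w, supNorm G (T w) = supNorm G w)
    (hTI : ∀ w, T (Complex.I • w) = -(Complex.I • T w)) :
    Nat.card (ComplexStructuresUpToIsometry (supNormEquivalentNorm e hC h1).Space) = 1 := by
  refine card_complexStructures_eq_one _ (supNormConj_mulI_sq e hC h1)
    (norm_supNormConj_mulI e hC h1)
    (fun J _ hJ => eq_supNormConj_of_rigid e hC h1 rigid J hJ)
    ⟨(supNormEquiv e hC h1).trans (T.trans (supNormEquiv e hC h1).symm), fun v => ?_, fun v => ?_⟩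
  · rw [norm_eq_supNorm, norm_eq_supNorm, LinearEquiv.trans_apply, LinearEquiv.trans_apply,
      LinearEquiv.apply_symm_apply, hT]
  · rw [supNormConj_apply, supNormConj_apply, ← map_neg]
    simp only [LinearEquiv.trans_apply, LinearEquiv.apply_symm_apply]
    exact congrArg _ (hTI _)

theorem card_eq_two_of_rigid
    (rigid : ∀ J : W →ₗ[ℝ] W,
      (∀ (a b : ℝ) (x : W), supNorm G (a • x + b • J x) = ‖(⟨a, b⟩ : ℂ)‖ * supNorm G x) →
      (∀ w, J w = Complex.I • w) ∨ ∀ w, J w = (-Complex.I) • w)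
    (hT : ¬∃ T : W ≃ₗ[ℝ] W, (∀ w, supNorm G (T w) = supNorm G w) ∧
      ∀ w, T (Complex.I • w) = -(Complex.I • T w)) :
    Nat.card (ComplexStructuresUpToIsometry (supNormEquivalentNorm e hC h1).Space) = 2 := by
  refine card_complexStructures_eq_two _ (supNormConj_mulI_sq e hC h1)
    (norm_supNormConj_mulI e hC h1)
    (fun J _ hJ => eq_supNormConj_of_rigid e hC h1 rigid J hJ) ?_
  rintro ⟨T, hTn, hTI⟩
  refine hT ⟨(supNormEquiv e hC h1).symm.trans (T.trans (supNormEquiv e hC h1)), fun w => ?_,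
    fun w => ?_⟩
  · have := hTn ((supNormEquiv e hC h1).symm w)
    rw [norm_eq_supNorm, norm_eq_supNorm, LinearEquiv.apply_symm_apply] at this
    exact this
  · have := hTI ((supNormEquiv e hC h1).symm w)
    rw [supNormConj_apply, supNormConj_apply, LinearEquiv.apply_symm_apply, ← map_neg,
      LinearEquiv.eq_symm_apply] at this
    exact this

end Transfer

/-! ### The complex normed space of an operator of square -1. -/

section ComplexSpace

/-- The complex space given by a bounded real operator of square `-1`. -/
def ComplexSpace {V : Type u} [NormedAddCommGroup V] [NormedSpace ℝ V] (I : V →L[ℝ] V)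
    (_hI : ∀ v, I (I v) = -v) : Type u := V

namespace ComplexSpace

variable {V : Type u} [NormedAddCommGroup V] [NormedSpace ℝ V] {I : V →L[ℝ] V}
  {hI : ∀ v, I (I v) = -v}

instance : AddCommGroup (ComplexSpace I hI) := inferInstanceAs (AddCommGroup V)

/-- The identity map from the real space. -/
def of : V ≃+ ComplexSpace I hI := AddEquiv.refl V

instance : SMul ℂ (ComplexSpace I hI) := ⟨fun z w => of (z.re • of.symm w + z.im • I (of.symm w))⟩

theorem symm_smul (z : ℂ) (w : ComplexSpace I hI) :
    of.symm (z • w) = z.re • of.symm w + z.im • I (of.symm w) := rfl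

instance : Module ℂ (ComplexSpace I hI) where
  one_smul w := of.symm.injective (by simp [symm_smul])
  mul_smul z z' w := of.symm.injective (by
    simp only [symm_smul, Complex.mul_re, Complex.mul_im, map_add, map_smul, hI]
    module)
  smul_zero z := of.symm.injective (by simp [symm_smul])
  smul_add z w w' := of.symm.injective (by
    simp only [symm_smul, map_add]
    module)
  add_smul z z' w := of.symm.injective (by
    simp only [symm_smul, map_add, Complex.add_re, Complex.add_im]
    module)
  zero_smul w := of.symm.injective (by simp [symm_smul])

/-- The orbit map of a vector. -/
noncomputable def orbit (w : ComplexSpace I hI) : ℂ →L[ℝ] V :=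
  Complex.reCLM.smulRight (of.symm w) + Complex.imCLM.smulRight (I (of.symm w))

/-- This is the supremum of the original norm over the multiples zw with |z| ≤ 1, which forces
complex homogeneity at the cost of a bounded factor. -/
noncomputable instance : Norm (ComplexSpace I hI) := ⟨fun w => ‖orbit w‖⟩

theorem norm_def (w : ComplexSpace I hI) : ‖w‖ = ‖orbit w‖ := rfl

theorem norm_le_of_forall {w : ComplexSpace I hI} {r : ℝ} (hr : 0 ≤ r)
    (h : ∀ z : ℂ, ‖of.symm (z • w)‖ ≤ r * ‖z‖) : ‖w‖ ≤ r :=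
  ContinuousLinearMap.opNorm_le_bound _ hr h

theorem norm_symm_smul_le (z : ℂ) (w : ComplexSpace I hI) : ‖of.symm (z • w)‖ ≤ ‖w‖ * ‖z‖ :=
  (orbit w).le_opNorm z

theorem norm_symm_le (w : ComplexSpace I hI) : ‖of.symm w‖ ≤ ‖w‖ := by
  simpa using norm_symm_smul_le 1 w

theorem norm_smul_le (z : ℂ) (w : ComplexSpace I hI) : ‖z • w‖ ≤ ‖z‖ * ‖w‖ := by
  refine norm_le_of_forall (mul_nonneg (norm_nonneg z) (norm_nonneg (orbit w))) fun z' => ?_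
  rw [smul_smul]
  refine (norm_symm_smul_le _ w).trans_eq ?_
  rw [norm_mul]
  ring

theorem core : NormedSpace.Core ℂ (ComplexSpace I hI) where
  norm_nonneg w := norm_nonneg (orbit w)
  norm_smul z w := by
    refine le_antisymm (norm_smul_le z w) ?_
    by_cases hz : z = 0
    · rw [hz, norm_zero, zero_mul]
      exact norm_nonneg (orbit _)
    · have := norm_smul_le z⁻¹ (z • w)
      rwa [smul_smul, inv_mul_cancel₀ hz, one_smul, norm_inv, le_inv_mul_iff₀ (norm_pos_iff.mpr hz)]
        at this
  norm_triangle w w' := by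
    refine norm_le_of_forall (add_nonneg (norm_nonneg (orbit w)) (norm_nonneg (orbit w')))
      fun z => ?_
    rw [smul_add, map_add, add_mul]
    exact (norm_add_le _ _).trans (add_le_add (norm_symm_smul_le z w) (norm_symm_smul_le z w'))
  norm_eq_zero_iff w := by
    constructor
    · intro h
      have := norm_symm_le w
      rw [h] at this
      exact of.symm.injective (by rw [norm_le_zero_iff.mp this, map_zero])
    · rintro rfl
      rw [norm_def, norm_eq_zero]
      ext z
      simp [orbit]

noncomputable instance : NormedAddCommGroup (ComplexSpace I hI) := NormedAddCommGroup.ofCore core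

noncomputable instance : NormedSpace ℂ (ComplexSpace I hI) := NormedSpace.ofCore core

theorem symm_real_smul (r : ℝ) (w : ComplexSpace I hI) : of.symm (r • w) = r • of.symm w := by
  rw [← Complex.coe_smul, symm_smul]
  simp

variable (I hI) in
/-- The identity map from the real space, as a linear map. -/
def ofLinear : V ≃ₗ[ℝ] ComplexSpace I hI where
  __ := of
  map_smul' r v := of.symm.injective (by
    simp only [RingHom.id_apply, symm_real_smul]
    rfl)

variable (I hI) in
/-- The identity map from the real space, as an isomorphism. -/
noncomputable def ofL : V ≃L[ℝ] ComplexSpace I hI :=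
  (ofLinear I hI).toContinuousLinearEquivOfBounds (1 + ‖I‖) 1
    (fun v => by
      refine norm_le_of_forall (by positivity) fun z => ?_
      have h : of.symm (z • ofLinear I hI v) = z.re • v + z.im • I v := rfl
      rw [h]
      refine (norm_add_le _ _).trans ?_
      rw [norm_smul, norm_smul, Real.norm_eq_abs, Real.norm_eq_abs]
      have h1 := Complex.abs_re_le_norm z
      have h2 := Complex.abs_im_le_norm z
      have h3 := I.le_opNorm v
      calc |z.re| * ‖v‖ + |z.im| * ‖I v‖ ≤ ‖z‖ * ‖v‖ + ‖z‖ * (‖I‖ * ‖v‖) := by gcongr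
        _ = _ := by ring)
    (fun w => by
      rw [one_mul]
      exact norm_symm_le w)

/-- A complex functional is bounded by the bound of its real part on the real space. -/
theorem norm_apply_le_of_re_le {F : ComplexSpace I hI →ₗ[ℂ] ℂ} {r : ℝ} (hr : 0 ≤ r)
    (h : ∀ w, |(F w).re| ≤ r * ‖of.symm w‖) (w : ComplexSpace I hI) : ‖F w‖ ≤ r * ‖w‖ := by
  by_cases h0 : F w = 0
  · rw [h0, norm_zero]
    exact mul_nonneg hr (norm_nonneg w)
  -- Rotating w by this unimodular number makes the value of F real and nonnegative.
  · set z : ℂ := (starRingEnd ℂ) (F w) / ‖F w‖ with hz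
    have hn : (‖F w‖ : ℂ) ≠ 0 := by exact_mod_cast norm_ne_zero_iff.mpr h0
    have hzn : ‖z‖ = 1 := by
      rw [hz, norm_div, Complex.norm_conj, Complex.norm_real, norm_norm,
        div_self (norm_ne_zero_iff.mpr h0)]
    have h1 : F (z • w) = ‖F w‖ := by
      rw [map_smul, smul_eq_mul, hz, div_mul_eq_mul_div, mul_comm, Complex.mul_conj,
        Complex.normSq_eq_norm_sq, div_eq_iff hn]
      push_cast
      ring
    have h2 := h (z • w)
    rw [h1, Complex.ofReal_re, abs_norm] at h2
    refine h2.trans (mul_le_mul_of_nonneg_left ?_ hr)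
    simpa [hzn] using norm_symm_smul_le z w

end ComplexSpace

end ComplexSpace

/-! ### Complexification of a real space and its conjugation. -/

section Complexification

variable (E : Type u) [NormedAddCommGroup E] [NormedSpace ℝ E]

/-- The quarter turn `(x, y) ↦ (-y, x)`. -/
noncomputable def quarterTurn : E × E →L[ℝ] E × E :=
  (-ContinuousLinearMap.snd ℝ E E).prod (ContinuousLinearMap.fst ℝ E E)

theorem quarterTurn_quarterTurn (v : E × E) : quarterTurn E (quarterTurn E v) = -v := rfl

/-- The complexification of a real normed space. -/
abbrev Complexification : Type u := ComplexSpace (quarterTurn E) (quarterTurn_quarterTurn E)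

namespace Complexification

open ComplexSpace

variable {E}

theorem symm_smul_fst (z : ℂ) (w : Complexification E) :
    (of.symm (z • w)).1 = z.re • (of.symm w).1 - z.im • (of.symm w).2 := by
  rw [symm_smul, sub_eq_add_neg, ← smul_neg]
  rfl

theorem symm_smul_snd (z : ℂ) (w : Complexification E) :
    (of.symm (z • w)).2 = z.re • (of.symm w).2 + z.im • (of.symm w).1 := rfl

/-- The complex-linear extension of a real functional. -/
noncomputable def extend (φ : E →L[ℝ] ℝ) : Complexification E →L[ℂ] ℂ :=
  LinearMap.mkContinuous
    { toFun := fun w => ⟨φ (of.symm w).1, φ (of.symm w).2⟩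
      map_add' := fun w w' => by
        apply Complex.ext <;> simp
      map_smul' := fun z w => by
        rw [symm_smul_fst, symm_smul_snd]
        apply Complex.ext <;> simp } ‖φ‖
    (norm_apply_le_of_re_le (norm_nonneg φ) fun w =>
      (φ.le_opNorm _).trans (mul_le_mul_of_nonneg_left (norm_fst_le (of.symm w)) (norm_nonneg φ)))

theorem extend_apply (φ : E →L[ℝ] ℝ) (w : Complexification E) :
    extend φ w = ⟨φ (of.symm w).1, φ (of.symm w).2⟩ := rfl

theorem norm_extend_le (φ : E →L[ℝ] ℝ) : ‖extend φ‖ ≤ ‖φ‖ :=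
  LinearMap.mkContinuous_norm_le _ (norm_nonneg φ) _

/-- The embedding of the real space. -/
noncomputable def incl (x : E) : Complexification E := of (x, 0)

theorem extend_incl (φ : E →L[ℝ] ℝ) (x : E) : extend φ (incl x) = φ x := by
  rw [extend_apply, incl, AddEquiv.symm_apply_apply, map_zero]
  rfl

theorem norm_incl_le (x : E) : ‖incl x‖ ≤ ‖x‖ := by
  refine norm_le_of_forall (norm_nonneg x) fun z => max_le ?_ ?_
  · rw [symm_smul_fst, incl, AddEquiv.symm_apply_apply, smul_zero, sub_zero, norm_smul, mul_comm]
    gcongr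
    exact Complex.abs_re_le_norm z
  · rw [symm_smul_snd, incl, AddEquiv.symm_apply_apply, smul_zero, zero_add, norm_smul, mul_comm]
    gcongr
    exact Complex.abs_im_le_norm z

variable (E) in
/-- Complex conjugation. -/
noncomputable def conj : Complexification E ≃ₗ[ℝ] Complexification E where
  toFun w := of ((of.symm w).1, -(of.symm w).2)
  invFun w := of ((of.symm w).1, -(of.symm w).2)
  map_add' w w' := of.symm.injective (by simp [add_comm])
  map_smul' r w := of.symm.injective (by simp [symm_real_smul])
  left_inv w := of.symm.injective (by simp)
  right_inv w := of.symm.injective (by simp)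

theorem symm_conj (w : Complexification E) :
    of.symm (conj E w) = ((of.symm w).1, -(of.symm w).2) := rfl

theorem conj_conj (w : Complexification E) : conj E (conj E w) = w := (conj E).left_inv w

theorem conj_smul (z : ℂ) (w : Complexification E) :
    conj E (z • w) = (starRingEnd ℂ) z • conj E w := of.symm.injective (by
  refine Prod.ext ?_ ?_
  · rw [symm_smul_fst, symm_conj, symm_conj, symm_smul_fst]
    simp
  · rw [symm_smul_snd, symm_conj, symm_conj, symm_smul_snd]
    simp [add_comm])

theorem extend_conj (φ : E →L[ℝ] ℝ) (w : Complexification E) :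
    extend φ (conj E w) = (starRingEnd ℂ) (extend φ w) := by
  rw [extend_apply, extend_apply, symm_conj]
  apply Complex.ext <;> simp

theorem norm_conj_le (w : Complexification E) : ‖conj E w‖ ≤ ‖w‖ := by
  refine norm_le_of_forall (norm_nonneg w) fun z => ?_
  have h : z • conj E w = conj E ((starRingEnd ℂ) z • w) := by
    rw [conj_smul, Complex.conj_conj]
  rw [h, symm_conj, ← Complex.norm_conj z]
  refine le_trans (le_of_eq ?_) (norm_symm_smul_le _ w)
  rw [Prod.norm_def, Prod.norm_def, norm_neg]

end Complexification

end Complexification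

/-! ### Squares: a norm with a single complex structure. -/

section Squares

open Complexification

variable {Z : Type u} [NormedAddCommGroup Z] [NormedSpace ℝ Z] {A : Type v}
  (L : LinkedSystem ℝ Z A 1)

namespace LinkedSystem

/-- The peak data on the complexification of `ℝ × Z` given by a linked system on `Z`. -/
noncomputable def realPeakData : PeakData (Complexification (ℝ × Z)) A :=
  L.toPeakData (fun z => incl (0, z))
    (fun φ => extend (φ.comp (ContinuousLinearMap.snd ℝ ℝ Z)))
    (extend (ContinuousLinearMap.fst ℝ ℝ Z))
    (fun z => (norm_incl_le _).trans (by simp [Prod.norm_def]))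
    (fun φ => (norm_extend_le _).trans ((φ.opNorm_comp_le _).trans
      (mul_le_of_le_one_right (norm_nonneg φ) (ContinuousLinearMap.norm_snd_le ℝ ℝ Z))))
    (fun φ z h => by simp [extend_incl, h]) (fun φ z h => by simp [extend_incl, h])
    ((norm_extend_le _).trans (ContinuousLinearMap.norm_fst_le ℝ ℝ Z))
    (fun z => by simp [extend_incl])

/-- The special functional on the complexification of `ℝ × Z`. -/
noncomputable def realSpecial : Unit → Complexification (ℝ × Z) →L[ℂ] ℂ :=
  fun _ => (2 : ℂ) • extend (ContinuousLinearMap.fst ℝ ℝ Z)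

theorem norm_realSpecial (j : Unit) : ‖realSpecial (Z := Z) j‖ ≤ 2 := by
  rw [realSpecial, norm_smul, Complex.norm_ofNat]
  have := (norm_extend_le _).trans (ContinuousLinearMap.norm_fst_le ℝ ℝ Z)
  linarith

theorem extend_fst_ne_zero : extend (ContinuousLinearMap.fst ℝ ℝ Z) ≠ 0 := fun h => by
  have h1 := extend_incl (ContinuousLinearMap.fst ℝ ℝ Z) (1, 0)
  rw [h] at h1
  simp at h1

variable {ε : ℝ}

/-- The special functional 2σ has value 2 at the unit vector of the ℝ factor, where the norm is at
most 1 and the faces at most 1/8; it thus has a sign, and so has σ. Together with the linked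
functionals it is total on both real components. -/
theorem real_rigid (hε : 0 < ε) (hε' : ε ≤ 1 / 8)
    (J : Complexification (ℝ × Z) →ₗ[ℝ] Complexification (ℝ × Z))
    (hq : ∀ (a b : ℝ) (x : Complexification (ℝ × Z)),
      supNorm (L.realPeakData.family realSpecial ε) (a • x + b • J x) =
        ‖(⟨a, b⟩ : ℂ)‖ * supNorm (L.realPeakData.family realSpecial ε) x) :
    (∀ w, J w = Complex.I • w) ∨ ∀ w, J w = (-Complex.I) • w := by
  refine L.eq_or_eq_neg (s := realSpecial) _ _ _ _ _ _ extend_fst_ne_zero norm_realSpecial ?_ ?_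
    hε hε' hq ?_
  · intro j z
    simp [realSpecial, extend_incl]
  · intro w h1 h2
    have h1' : extend (ContinuousLinearMap.fst ℝ ℝ Z) w = 0 := by simpa [realSpecial] using h1 ()
    rw [extend_apply] at h1'
    have ha := congrArg Complex.re h1'
    have hb := congrArg Complex.im h1'
    have hy : (ComplexSpace.of.symm w).1.2 = 0 := L.total _ fun k hk => by
      have := h2 k hk
      rw [extend_apply] at this
      exact congrArg Complex.re this
    have hz : (ComplexSpace.of.symm w).2.2 = 0 := L.total _ fun k hk => by
      have := h2 k hk
      rw [extend_apply] at this
      exact congrArg Complex.im this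
    exact ComplexSpace.of.symm.injective (Prod.ext (Prod.ext ha hy) (Prod.ext hb hz))
  · set D := L.realPeakData with hD
    set x₀ : Complexification (ℝ × Z) := incl (1, 0) with hx₀
    have hxn : ‖x₀‖ ≤ 1 := (norm_incl_le _).trans (by simp [Prod.norm_def])
    have hσ : extend (ContinuousLinearMap.fst ℝ ℝ Z) x₀ = 1 := by
      rw [hx₀, extend_incl]
      simp
    have hs : ‖realSpecial () x₀‖ = 2 := by
      rw [realSpecial, smul_apply, hσ]
      simp
    have hf (a : A) : D.f a x₀ = 0 := by
      change extend ((L.f a).comp (ContinuousLinearMap.snd ℝ ℝ Z)) x₀ = 0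
      rw [hx₀, extend_incl]
      simp
    have hg (p : A × Fin 3) : ‖D.g ε p x₀‖ ≤ 1 / 8 := by
      rw [PeakData.g_apply, hf, mul_zero, zero_add, norm_mul, norm_mul, PeakData.norm_phase,
        Complex.norm_real, Real.norm_of_nonneg hε.le, mul_one]
      have : ‖D.h p.1 x₀‖ ≤ 1 := ((D.h p.1).le_of_opNorm_le (D.norm_h p.1) _).trans (by simpa)
      nlinarith
    have key := mem_eigenDual_or_of_eventually hq (F := realSpecial ()) (x₀ := x₀)
      (eventually_supNorm_eq (i := Sum.inl ()) (D.norm_family _ hε hε' norm_realSpecial)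
        (η := 1 / 2) (by norm_num)
        (by change ‖x₀‖ + 1 / 2 ≤ ‖realSpecial () x₀‖; linarith) fun j => by
          rcases j with j | p
          · exact Or.inl fun y => rfl
          · right
            change ‖D.g ε p x₀‖ + 1 / 2 ≤ ‖realSpecial () x₀‖
            linarith [hg p])
    have h2 {c : ℂ} (h : realSpecial () ∈ eigenDual J c) :
        extend (ContinuousLinearMap.fst ℝ ℝ Z) ∈ eigenDual J c :=
      (Submodule.smul_mem_iff _ two_ne_zero).mp h
    exact key.imp (fun h => ⟨h2 h, fun _ => h⟩) fun h => ⟨h2 h, fun _ => h⟩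

/-- The functionals `f`, `u`, σ extend real ones, the marks and the corrections `u a (x a)` are
real, and conjugation permutes the three phases; so it permutes the moduli in the family. -/
theorem supNorm_conj_le (hε : 0 < ε) (hε' : ε ≤ 1 / 8) (w : Complexification (ℝ × Z)) :
    supNorm (L.realPeakData.family realSpecial ε) (conj (ℝ × Z) w) ≤
      supNorm (L.realPeakData.family realSpecial ε) w := by
  set D := L.realPeakData with hD
  refine supNorm_le ((norm_conj_le w).trans (norm_le_supNorm w)) fun i => ?_
  obtain ⟨i', hi'⟩ : ∃ i', D.family realSpecial ε i (conj (ℝ × Z) w) =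
      (starRingEnd ℂ) (D.family realSpecial ε i' w) := by
    rcases i with j | ⟨a, k⟩
    · refine ⟨Sum.inl j, ?_⟩
      change (2 : ℂ) * extend _ (conj _ w) = (starRingEnd ℂ) ((2 : ℂ) * extend _ w)
      rw [extend_conj, map_mul, Complex.conj_ofNat]
    · have hf : D.f a (conj _ w) = (starRingEnd ℂ) (D.f a w) := extend_conj _ w
      have hu : D.u a (conj _ w) = (starRingEnd ℂ) (D.u a w) := extend_conj _ w
      have hσ : D.σ (conj _ w) = (starRingEnd ℂ) (D.σ w) := extend_conj _ w
      have hc : (starRingEnd ℂ) (D.c a) = D.c a := by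
        change (starRingEnd ℂ) (if L.c a then (1 : ℂ) else 0) = _
        split_ifs <;> simp_all [D, realPeakData, toPeakData]
      have hx : (starRingEnd ℂ) (D.u a (D.x a)) = D.u a (D.x a) := by
        change (starRingEnd ℂ) (extend ((L.u a).comp (ContinuousLinearMap.snd ℝ ℝ Z)) (incl (0, L.x a)))
          = extend ((L.u a).comp (ContinuousLinearMap.snd ℝ ℝ Z)) (incl (0, L.x a))
        rw [extend_incl, Complex.conj_ofReal]
      have hh : D.h a (conj _ w) = (starRingEnd ℂ) (D.h a w) := by
        simp [PeakData.h, hf, hu, hσ, hc, hx, Complex.conj_ofNat]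
      obtain ⟨l, hl⟩ : ∃ l, (starRingEnd ℂ) (PeakData.phase l) = PeakData.phase k := by
        fin_cases k
        · exact ⟨1, by simp [PeakData.phase]⟩
        · exact ⟨0, by simp [PeakData.phase]⟩
        · exact ⟨2, by simp [PeakData.phase]⟩
      refine ⟨Sum.inr (a, l), ?_⟩
      change D.g ε (a, k) _ = (starRingEnd ℂ) (D.g ε (a, l) w)
      rw [PeakData.g_apply, PeakData.g_apply, hf, hh, ← hl]
      simp
  rw [hi', Complex.norm_conj]
  exact norm_apply_le_supNorm (D.norm_family _ hε hε' norm_realSpecial) i' w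

theorem exists_card_eq_one {X : Type*} [NormedAddCommGroup X] [NormedSpace ℝ X]
    (L : LinkedSystem ℝ Z A 1) (e : X ≃L[ℝ] Complexification (ℝ × Z)) :
    ∃ N : EquivalentNorm X, Nat.card (ComplexStructuresUpToIsometry N.Space) = 1 := by
  have hε : (0 : ℝ) < 1 / 8 := by norm_num
  refine ⟨_, card_eq_one_of_rigid e (L.realPeakData.norm_family _ hε le_rfl norm_realSpecial)
    one_le_two (L.real_rigid hε le_rfl) (conj (ℝ × Z)) (fun w => ?_) fun w => ?_⟩
  · refine le_antisymm (L.supNorm_conj_le hε le_rfl w) ?_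
    have := L.supNorm_conj_le hε le_rfl (conj (ℝ × Z) w)
    rwa [conj_conj] at this
  · rw [conj_smul, Complex.conj_I, neg_smul]

end LinkedSystem

/-- A Banach space isomorphic to a square has an equivalent norm with exactly one complex
structure. -/
theorem exists_equivalentNorm_card_eq_one (X : Type u) [NormedAddCommGroup X] [NormedSpace ℝ X]
    (Y : Type v) [NormedAddCommGroup Y] [NormedSpace ℝ Y] (e : X ≃L[ℝ] (Y × Y)) :
    ∃ N : EquivalentNorm X, Nat.card (ComplexStructuresUpToIsometry N.Space) = 1 := by
  rcases subsingleton_or_nontrivial Y with hY | hY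
  · have hX : Subsingleton X := e.injective.subsingleton
    let N : EquivalentNorm X :=
      { normSeminorm ℝ X with
        exists_lower := ⟨1, one_pos, fun x => by rw [one_mul]; exact le_rfl⟩
        exists_upper := ⟨1, one_pos, fun x => by rw [one_mul]; exact le_rfl⟩ }
    have : Subsingleton N.Space := hX
    refine ⟨N, card_complexStructures_eq_one 0 (fun x => Subsingleton.elim _ _) (fun a b x => ?_)
      (fun J _ _ => Or.inl (Subsingleton.elim _ _))
      ⟨LinearEquiv.refl ℝ _, fun x => rfl, fun x => Subsingleton.elim _ _⟩⟩
    rw [Subsingleton.elim x 0]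
    simp
  · obtain ⟨y₀, hy₀⟩ := exists_ne (0 : Y)
    obtain ⟨φ, -, hφ⟩ := exists_dual_vector ℝ y₀ (norm_ne_zero_iff.mpr hy₀)
    have hφ' : φ ((‖y₀‖)⁻¹ • y₀) = 1 := by
      rw [map_smul, hφ]
      exact inv_mul_cancel₀ (norm_ne_zero_iff.mpr hy₀)
    -- A line is split off Y to carry σ, and the linked system lives on its complement. The square
    -- of ℝ × Z underlies the complexification.
    obtain ⟨Z, _, _, A, ⟨eZ⟩, ⟨L⟩⟩ := exists_renormed_linkedSystem ℝ φ.ker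
    have eY : Y ≃L[ℝ] ℝ × φ.ker :=
      ContinuousLinearEquiv.equivOfRightInverse φ
        (ContinuousLinearMap.toSpanSingleton ℝ ((‖y₀‖)⁻¹ • y₀)) fun r => by
          rw [ContinuousLinearMap.toSpanSingleton_apply, map_smul, hφ', smul_eq_mul, mul_one]
    have eY' : Y ≃L[ℝ] ℝ × Z := eY.trans ((ContinuousLinearEquiv.refl ℝ ℝ).prodCongr eZ)
    exact L.exists_card_eq_one
      ((e.trans (eY'.prodCongr eY')).trans (ComplexSpace.ofL (quarterTurn (ℝ × Z)) (quarterTurn_quarterTurn _)))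

end Squares

/-! ### Functionals with equal modulus. -/

section ModulusRigidity

variable {W : Type*} [NormedAddCommGroup W] [NormedSpace ℂ W]

/-- The squared modulus of a functional is a quadratic form, recovered from its second differences
at any point. -/
theorem norm_apply_eq_of_eventually {F s : W →L[ℂ] ℂ} {x : W} (h : ∀ᶠ y in 𝓝 x, ‖F y‖ = ‖s y‖)
    (z : W) : ‖F z‖ = ‖s z‖ := by
  have hc : Tendsto (fun t : ℝ => x + (t : ℂ) • z) (𝓝 0) (𝓝 x) := by
    have : Continuous fun t : ℝ => x + (t : ℂ) • z := by fun_prop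
    simpa using this.tendsto 0
  obtain ⟨r, hr, hball⟩ := Metric.eventually_nhds_iff.mp (hc.eventually h)
  have h1 := hball (y := r / 2) (by simp [abs_of_pos hr, hr])
  have h2 := hball (y := -(r / 2)) (by simp [abs_of_pos hr, hr])
  have h0 := h.self_of_nhds
  have e (H : W →L[ℂ] ℂ) : ‖H (x + ((r / 2 : ℝ) : ℂ) • z)‖ ^ 2 +
      ‖H (x + ((-(r / 2) : ℝ) : ℂ) • z)‖ ^ 2 = 2 * (‖H x‖ ^ 2 + (r / 2) ^ 2 * ‖H z‖ ^ 2) := by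
    have := parallelogram_law_with_norm ℂ (H x) (((r / 2 : ℝ) : ℂ) • H z)
    rw [norm_smul, Complex.norm_real, mul_pow, Real.norm_eq_abs, sq_abs] at this
    rw [← this, Complex.ofReal_neg, neg_smul, ← sub_eq_add_neg, map_add, map_sub, map_smul]
  have e1 := e F
  rw [h1, h2, h0, e s] at e1
  have h3 : (r / 2) ^ 2 * (‖F z‖ ^ 2 - ‖s z‖ ^ 2) = 0 := by linear_combination -e1 / 2
  have h4 := (mul_eq_zero.mp h3).resolve_left (by positivity)
  exact (sq_eq_sq₀ (norm_nonneg _) (norm_nonneg _)).mp (sub_eq_zero.mp h4)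

theorem exists_eq_smul_of_norm_eq {F s : W →L[ℂ] ℂ} (hs : s ≠ 0) (h : ∀ z, ‖F z‖ = ‖s z‖) :
    ∃ c : ℂ, ‖c‖ = 1 ∧ F = c • s := by
  obtain ⟨z₀, hz₀⟩ : ∃ z, s z ≠ 0 := by
    by_contra! hcon
    exact hs (by ext z; simpa using hcon z)
  refine ⟨F z₀ / s z₀, ?_, ?_⟩
  · rw [norm_div, h, div_self (norm_ne_zero_iff.mpr hz₀)]
  · ext w
    have h1 : s (w - (s w / s z₀) • z₀) = 0 := by
      rw [map_sub, map_smul, smul_eq_mul, div_mul_cancel₀ _ hz₀, sub_self]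
    have h2 := h (w - (s w / s z₀) • z₀)
    rw [h1, norm_zero, norm_eq_zero, map_sub, map_smul, smul_eq_mul, sub_eq_zero] at h2
    rw [smul_apply, smul_eq_mul, h2]
    ring

end ModulusRigidity

/-! ### A plane summand with four special functionals. -/

/-- The Hilbertian sum of a complex plane with a complex normed space. -/
abbrev PlaneSum (Z : Type*) : Type _ := WithLp 2 (EuclideanSpace ℂ (Fin 2) × Z)

namespace PlaneSum

variable {Z : Type u} [NormedAddCommGroup Z]

theorem norm_sq (w : PlaneSum Z) : ‖w‖ ^ 2 = ‖w.fst 0‖ ^ 2 + ‖w.fst 1‖ ^ 2 + ‖w.snd‖ ^ 2 := by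
  rw [WithLp.prod_norm_sq_eq_of_L2, EuclideanSpace.norm_sq_eq, Fin.sum_univ_two]

/-- The vectors of the plane. -/
noncomputable def plane (a b : ℂ) : PlaneSum Z := WithLp.toLp 2 (!₂[a, b], 0)

@[simp]
theorem plane_fst_zero (a b : ℂ) : (plane a b : PlaneSum Z).fst 0 = a := rfl

@[simp]
theorem plane_fst_one (a b : ℂ) : (plane a b : PlaneSum Z).fst 1 = b := rfl

@[simp]
theorem plane_snd (a b : ℂ) : (plane a b : PlaneSum Z).snd = 0 := rfl

theorem norm_plane_sq (a b : ℂ) : ‖(plane a b : PlaneSum Z)‖ ^ 2 = ‖a‖ ^ 2 + ‖b‖ ^ 2 := by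
  rw [norm_sq]
  simp

/-- The whole space need not be Hilbertian, but displacements in the plane do not change the Z
component. This quantitative convexity is what rules out large flat pieces. -/
theorem parallelogram (w : PlaneSum Z) (a b : ℂ) :
    ‖w + plane a b‖ ^ 2 + ‖w - plane a b‖ ^ 2 = 2 * (‖w‖ ^ 2 + ‖(plane a b : PlaneSum Z)‖ ^ 2) := by
  have h0 := parallelogram_law_with_norm ℂ (w.fst 0) a
  have h1 := parallelogram_law_with_norm ℂ (w.fst 1) b
  rw [norm_plane_sq, norm_sq w, norm_sq (w + _), norm_sq (w - _)]
  simp only [WithLp.add_fst, WithLp.sub_fst, WithLp.add_snd, WithLp.sub_snd, PiLp.add_apply,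
    PiLp.sub_apply, plane_fst_zero, plane_fst_one, plane_snd, add_zero, sub_zero]
  linear_combination h0 + h1

variable [NormedSpace ℂ Z]

variable (Z) in
/-- The functionals which depend only on the plane component. -/
noncomputable def form (p q : ℂ) : PlaneSum Z →L[ℂ] ℂ :=
  p • (EuclideanSpace.proj 0).comp (WithLp.fstL 2 ℂ (EuclideanSpace ℂ (Fin 2)) Z) +
    q • (EuclideanSpace.proj 1).comp (WithLp.fstL 2 ℂ (EuclideanSpace ℂ (Fin 2)) Z)

theorem form_apply (p q : ℂ) (w : PlaneSum Z) : form Z p q w = p * w.fst 0 + q * w.fst 1 := rfl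

theorem norm_form_le {p q : ℂ} (h : ‖p‖ ^ 2 + ‖q‖ ^ 2 = 1) : ‖form Z p q‖ ≤ 1 := by
  refine ContinuousLinearMap.opNorm_le_bound _ zero_le_one fun w => ?_
  rw [one_mul, form_apply]
  refine (norm_add_le _ _).trans (abs_le_of_sq_le_sq' ?_ (norm_nonneg _)).2
  rw [norm_mul, norm_mul, norm_sq]
  have h1 := sq_nonneg (‖p‖ * ‖w.fst 1‖ - ‖q‖ * ‖w.fst 0‖)
  have h2 : (‖p‖ ^ 2 + ‖q‖ ^ 2) * (‖w.fst 0‖ ^ 2 + ‖w.fst 1‖ ^ 2) =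
      ‖w.fst 0‖ ^ 2 + ‖w.fst 1‖ ^ 2 := by rw [h, one_mul]
  nlinarith [sq_nonneg ‖w.snd‖]

/-- Four unit vectors of the plane with non-real cross-ratio. -/
noncomputable def vec : Fin 4 → ℂ × ℂ :=
  ![(1, 0), (0, 1), (3 / 5, 4 / 5), (5 / 13, 12 / 13 * Complex.I)]

theorem norm_vec (j : Fin 4) : ‖(vec j).1‖ ^ 2 + ‖(vec j).2‖ ^ 2 = 1 := by
  fin_cases j <;> simp [vec] <;> norm_num

/-- The special functionals. -/
noncomputable def special (Z : Type u) [NormedAddCommGroup Z] [NormedSpace ℂ Z] (j : Fin 4) :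
    PlaneSum Z →L[ℂ] ℂ := (2 : ℂ) • form Z (vec j).1 (vec j).2

theorem special_apply (j : Fin 4) (w : PlaneSum Z) :
    special Z j w = 2 * ((vec j).1 * w.fst 0 + (vec j).2 * w.fst 1) := rfl

theorem norm_special (j : Fin 4) : ‖special Z j‖ ≤ 2 := by
  rw [special, norm_smul, Complex.norm_ofNat]
  linarith [norm_form_le (Z := Z) (norm_vec j)]

/-- The point at which a special functional dominates. -/
noncomputable def peak (Z : Type u) [NormedAddCommGroup Z] [NormedSpace ℂ Z] (j : Fin 4) :
    PlaneSum Z := plane ((starRingEnd ℂ) (vec j).1) ((starRingEnd ℂ) (vec j).2)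

theorem norm_peak (j : Fin 4) : ‖peak Z j‖ = 1 := by
  have h : ‖peak Z j‖ ^ 2 = 1 := by
    rw [peak, norm_plane_sq, Complex.norm_conj, Complex.norm_conj, norm_vec]
  exact (pow_eq_one_iff_of_nonneg (norm_nonneg _) two_ne_zero).mp h

theorem special_peak_self (j : Fin 4) : ‖special Z j (peak Z j)‖ = 2 := by
  have h := norm_vec j
  rw [special_apply, peak, plane_fst_zero, plane_fst_one, Complex.mul_conj, Complex.mul_conj,
    Complex.normSq_eq_norm_sq, Complex.normSq_eq_norm_sq, ← Complex.ofReal_add, h]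
  simp

/-- The largest modulus of an inner product of two distinct vectors among the four is 12/13. The
margin below the peak value 2 is therefore 2/13. -/
theorem special_peak_ne {j k : Fin 4} (h : k ≠ j) : ‖special Z k (peak Z j)‖ ≤ 24 / 13 := by
  have key : ‖special Z k (peak Z j)‖ ^ 2 ≤ (24 / 13) ^ 2 := by
    rw [special_apply, peak, plane_fst_zero, plane_fst_one, ← Complex.normSq_eq_norm_sq]
    fin_cases j <;> fin_cases k <;> first | exact absurd rfl h | skip
    all_goals
      simp [vec, Complex.normSq_apply, Complex.conj_ofNat]
      try norm_num
  exact (abs_le_of_sq_le_sq' key (by norm_num)).2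

theorem special_ne_zero (j : Fin 4) : special Z j ≠ 0 := fun h => by
  have := special_peak_self (Z := Z) j
  simp [h] at this

end PlaneSum

namespace LinkedSystem

open PlaneSum

variable {Z : Type u} [NormedAddCommGroup Z] [NormedSpace ℂ Z] {A : Type v}
  (L : LinkedSystem ℂ Z A 1)

/-- The peak data on the sum of a plane with the space of a linked system. -/
noncomputable def planePeakData : PeakData (PlaneSum Z) A :=
  L.toPeakData (fun z => WithLp.toLp 2 (0, z))
    (fun φ => φ.comp (WithLp.sndL 2 ℂ (EuclideanSpace ℂ (Fin 2)) Z))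
    (form Z 1 0)
    (fun z => (WithLp.norm_toLp_snd 2 _ Z z).le)
    (fun φ => ContinuousLinearMap.opNorm_le_bound _ (norm_nonneg φ) fun w =>
      (φ.le_opNorm _).trans (mul_le_mul_of_nonneg_left (WithLp.norm_snd_le _ w) (norm_nonneg φ)))
    (fun φ z h => h) (fun φ z h => h)
    (norm_form_le (by simp))
    (fun z => by simp [form_apply])

variable {ε : ℝ}

theorem planePeakData_f_plane (a : A) (p q : ℂ) : L.planePeakData.f a (plane p q) = 0 :=
  map_zero (L.f a)

theorem norm_g_peak_le (hε : 0 < ε) (hε' : ε ≤ 1 / 8) (p : A × Fin 3) (j : Fin 4) :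
    ‖L.planePeakData.g ε p (peak Z j)‖ ≤ 1 / 8 := by
  obtain ⟨a, k⟩ := p
  have hf : L.planePeakData.f a (peak Z j) = 0 := L.planePeakData_f_plane a _ _
  rw [PeakData.g_apply, hf, mul_zero, zero_add, norm_mul, norm_mul, PeakData.norm_phase,
    Complex.norm_real, Real.norm_of_nonneg hε.le, mul_one]
  have : ‖L.planePeakData.h a (peak Z j)‖ ≤ 1 :=
    ((L.planePeakData.h a).le_of_opNorm_le (L.planePeakData.norm_h a) _).trans
      (by rw [norm_peak, one_mul])
  nlinarith

/-- The new norm. -/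
noncomputable def planeNorm (ε : ℝ) : PlaneSum Z → ℝ :=
  supNorm (L.planePeakData.family (special Z) ε)

theorem peak_margin (hε : 0 < ε) (hε' : ε ≤ 1 / 8) (j : Fin 4) :
    ‖peak Z j‖ + 2 / 13 ≤ ‖L.planePeakData.family (special Z) ε (Sum.inl j) (peak Z j)‖ ∧
    ∀ i, (∀ y, ‖L.planePeakData.family (special Z) ε i y‖ =
        ‖L.planePeakData.family (special Z) ε (Sum.inl j) y‖) ∨
      ‖L.planePeakData.family (special Z) ε i (peak Z j)‖ + 2 / 13 ≤
        ‖L.planePeakData.family (special Z) ε (Sum.inl j) (peak Z j)‖ := by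
  have h : ‖L.planePeakData.family (special Z) ε (Sum.inl j) (peak Z j)‖ = 2 :=
    special_peak_self j
  rw [h, norm_peak]
  refine ⟨by norm_num, fun i => ?_⟩
  rcases i with k | p
  · by_cases hk : k = j
    · exact Or.inl fun y => by rw [hk]
    · right
      have : ‖L.planePeakData.family (special Z) ε (Sum.inl k) (peak Z j)‖ ≤ 24 / 13 :=
        special_peak_ne hk
      linarith
  · right
    have : ‖L.planePeakData.family (special Z) ε (Sum.inr p) (peak Z j)‖ ≤ 1 / 8 :=
      L.norm_g_peak_le hε hε' p j
    linarith

/-- Each special functional has a sign by its peak; the third, a combination of the first two,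
forces these to agree, and the first two span all functionals of the plane, σ included. -/
theorem plane_rigid (hε : 0 < ε) (hε' : ε ≤ 1 / 8) (J : PlaneSum Z →ₗ[ℝ] PlaneSum Z)
    (hq : ∀ (a b : ℝ) (x : PlaneSum Z),
      supNorm (L.planePeakData.family (special Z) ε) (a • x + b • J x) =
        ‖(⟨a, b⟩ : ℂ)‖ * supNorm (L.planePeakData.family (special Z) ε) x) :
    (∀ w, J w = Complex.I • w) ∨ ∀ w, J w = (-Complex.I) • w := by
  refine L.eq_or_eq_neg (s := special Z) _ _ _ _ _ _ ?_ norm_special ?_ ?_ hε hε' hq ?_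
  · intro h
    have : form Z 1 0 (plane 1 0) = 0 := by rw [h]; rfl
    simp [form_apply] at this
  · intro j z
    simp [special_apply]
  · intro w h1 h2
    have h10 := h1 0
    have h11 := h1 1
    have hz : w.snd = 0 := L.total _ fun k hk => h2 k hk
    have hn : ‖w‖ ^ 2 = 0 := by
      rw [norm_sq, hz]
      simp_all [special_apply, vec]
    simpa using hn
  · have key (j : Fin 4) := mem_eigenDual_or_of_eventually hq (F := special Z j) (x₀ := peak Z j)
      (eventually_supNorm_eq (i := Sum.inl j)
        (L.planePeakData.norm_family _ hε hε' norm_special) (by norm_num)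
        (L.peak_margin hε hε' j).1 (L.peak_margin hε hε' j).2)
    have e2 : (3 / 5 : ℂ) • special Z 0 + (4 / 5 : ℂ) • special Z 1 = special Z 2 := by
      ext w
      simp [special_apply, vec]
      ring
    have e3 : (5 / 13 : ℂ) • special Z 0 + (12 / 13 * Complex.I : ℂ) • special Z 1 =
        special Z 3 := by
      ext w
      simp [special_apply, vec]
      ring
    have eσ : form Z 1 0 = (1 / 2 : ℂ) • special Z 0 := by
      ext w
      simp [special_apply, form_apply, vec]
    have fin {c : ℂ} (h0 : special Z 0 ∈ eigenDual J c) (h1 : special Z 1 ∈ eigenDual J c) :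
        form Z 1 0 ∈ eigenDual J c ∧ ∀ j, special Z j ∈ eigenDual J c := by
      refine ⟨by rw [eσ]; exact Submodule.smul_mem _ _ h0, fun j => ?_⟩
      fin_cases j
      · exact h0
      · exact h1
      · exact e2 ▸ Submodule.add_mem _ (Submodule.smul_mem _ _ h0) (Submodule.smul_mem _ _ h1)
      · exact e3 ▸ Submodule.add_mem _ (Submodule.smul_mem _ _ h0) (Submodule.smul_mem _ _ h1)
    refine (mem_eigenDual_and_of_combination (c := 3 / 5) (d := 4 / 5) (by norm_num) (by norm_num)
      (special_ne_zero 0) (special_ne_zero 1) (key 0) (key 1) (by rw [e2]; exact key 2)).imp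
      (fun h => fin h.1 h.2) fun h => fin h.1 h.2

/-- A functional which gives the norm on a ball of fixed size, at a fixed height. -/
def IsFlat (q : PlaneSum Z → ℝ) (F : PlaneSum Z →L[ℂ] ℂ) (x₀ : PlaneSum Z) : Prop :=
  q x₀ = 2 ∧ ∀ y, q (y - x₀) ≤ 1 / 13 → q y = ‖F y‖

theorem isFlat_special (hε : 0 < ε) (hε' : ε ≤ 1 / 8) (j : Fin 4) :
    IsFlat (L.planeNorm ε) (special Z j) (peak Z j) := by
  have h (y) (hy : L.planeNorm ε (y - peak Z j) ≤ 1 / 13) :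
      L.planeNorm ε y = ‖special Z j y‖ :=
    -- The radius 1/13 in `IsFlat` is half the margin 2/13.
    supNorm_eq_of_peak (i := Sum.inl j) (L.planePeakData.norm_family _ hε hε' norm_special)
      (L.peak_margin hε hε' j).1 (L.peak_margin hε hε' j).2 (hy.trans (by norm_num))
  refine ⟨?_, h⟩
  rw [h, special_peak_self]
  rw [sub_self]
  simp [planeNorm, supNorm]

/-- The norm given by the functionals `g` alone is not locally the modulus of a functional on a ball
of fixed size. -/
theorem not_flat_g (hε : 0 < ε) (hε' : ε ≤ 1 / 20000) (F : PlaneSum Z →L[ℂ] ℂ) (x₀ : PlaneSum Z)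
    (h2 : supNorm (L.planePeakData.g ε) x₀ ≤ 2)
    (h : ∀ y ∈ Metric.ball x₀ (1 / 26), supNorm (L.planePeakData.g ε) y = ‖F y‖) : False := by
  have hC := L.planePeakData.norm_g hε
  -- The plane has dimension two, so F vanishes on some nonzero vector of it, scaled here to fit
  -- inside the ball of radius 1/26.
  obtain ⟨a, b, hab, hF⟩ : ∃ a b : ℂ, ‖(plane a b : PlaneSum Z)‖ = 1 / 27 ∧ F (plane a b) = 0 := by
    obtain ⟨a, b, hab, hF⟩ : ∃ a b : ℂ, (plane a b : PlaneSum Z) ≠ 0 ∧ F (plane a b) = 0 := by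
      have ne {a b : ℂ} (h : a ≠ 0 ∨ b ≠ 0) : (plane a b : PlaneSum Z) ≠ 0 := fun h0 => by
        have h1 := congrArg (fun w : PlaneSum Z => w.fst 0) h0
        have h2 := congrArg (fun w : PlaneSum Z => w.fst 1) h0
        simp at h1 h2
        tauto
      by_cases h0 : F (plane 1 0) = 0
      · exact ⟨1, 0, ne (by simp), h0⟩
      · refine ⟨F (plane 0 1), -F (plane 1 0), ne (by simp [h0]), ?_⟩
        have : (plane (F (plane 0 1)) (-F (plane 1 0)) : PlaneSum Z) =
            F (plane 0 1) • plane 1 0 - F (plane 1 0) • plane 0 1 := by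
          apply (WithLp.equiv 2 _).injective
          refine Prod.ext ?_ ?_
          · ext i
            fin_cases i <;> simp [plane]
          · simp [plane]
        rw [this, map_sub, map_smul, map_smul, smul_eq_mul, smul_eq_mul]
        ring
    set t : ℂ := ((1 / 27 / ‖(plane a b : PlaneSum Z)‖ : ℝ) : ℂ) with ht
    have e : (plane (t * a) (t * b) : PlaneSum Z) = t • plane a b := by
      apply (WithLp.equiv 2 _).injective
      refine Prod.ext ?_ ?_
      · ext i
        fin_cases i <;> simp [plane]
      · simp [plane]
    refine ⟨t * a, t * b, ?_, ?_⟩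
    · rw [e, norm_smul, ht, Complex.norm_real, Real.norm_of_nonneg (by positivity),
        div_mul_cancel₀ _ (norm_ne_zero_iff.mpr hab)]
    · rw [e, map_smul, hF, smul_zero]
  have h0 := h x₀ (Metric.mem_ball_self (by norm_num))
  have hp : ‖x₀ + plane a b‖ ≤ ‖F x₀‖ := by
    refine (norm_le_supNorm (G := L.planePeakData.g ε) _).trans_eq ?_
    rw [h, map_add, hF, add_zero]
    rw [mem_ball_iff_norm, add_sub_cancel_left, hab]
    norm_num
  have hm : ‖x₀ - plane a b‖ ≤ ‖F x₀‖ := by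
    refine (norm_le_supNorm (G := L.planePeakData.g ε) _).trans_eq ?_
    rw [h, map_sub, hF, sub_zero]
    rw [mem_ball_iff_norm, sub_sub_cancel_left, norm_neg, hab]
    norm_num
  have hu : ‖F x₀‖ ≤ (1 + 2 * ε) * ‖x₀‖ := by
    rw [← h0]
    exact supNorm_le_mul hC (by linarith) x₀
  have hn : ‖x₀‖ ≤ 2 := (norm_le_supNorm (G := L.planePeakData.g ε) x₀).trans h2
  -- Both x₀ ± v have norm at most (1 + 2ε)‖x₀‖, whence 1/27² ≤ ((1 + 2ε)² - 1)‖x₀‖² ≤ 4/4000, which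
  -- is false.
  have hpar := parallelogram x₀ a b
  rw [hab] at hpar
  have s1 := pow_le_pow_left₀ (norm_nonneg _) hp 2
  have s2 := pow_le_pow_left₀ (norm_nonneg _) hm 2
  have s3 := pow_le_pow_left₀ (norm_nonneg _) hu 2
  have s4 : ‖x₀‖ ^ 2 ≤ 4 := by nlinarith [norm_nonneg x₀]
  have s5 : (1 + 2 * ε) ^ 2 ≤ 1 + 1 / 4000 := by nlinarith
  have s6 : (1 + 2 * ε) ^ 2 * ‖x₀‖ ^ 2 ≤ (1 + 1 / 4000) * ‖x₀‖ ^ 2 := by gcongr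
  rw [mul_pow] at s3
  linarith

/-- If F had the modulus of no special functional, the set where |F| differs from all four moduli
would be open and dense. On it, inside the ball, the norm comes from the old norm and the faces
alone; by continuity this holds on the whole ball, against `not_flat_g`. -/
theorem exists_eq_special_of_isFlat (hε : 0 < ε) (hε' : ε ≤ 1 / 20000)
    {F : PlaneSum Z →L[ℂ] ℂ} {x₀ : PlaneSum Z} (hF : IsFlat (L.planeNorm ε) F x₀) :
    ∃ j, ∃ c : ℂ, ‖c‖ = 1 ∧ F = c • special Z j := by
  by_contra hcon
  have hε8 : ε ≤ 1 / 8 := by linarith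
  have hCf := L.planePeakData.norm_family (special Z) hε hε8 norm_special
  have hC := L.planePeakData.norm_g hε
  have hop (j : Fin 4) : IsOpen {y | ‖F y‖ = ‖special Z j y‖}ᶜ :=
    (isClosed_eq (by fun_prop) (by fun_prop)).isOpen_compl
  have hd (j : Fin 4) : Dense {y | ‖F y‖ = ‖special Z j y‖}ᶜ := by
    rw [← interior_eq_empty_iff_dense_compl, Set.eq_empty_iff_forall_notMem]
    intro x hx
    exact hcon ⟨j, exists_eq_smul_of_norm_eq (special_ne_zero j)
      (norm_apply_eq_of_eventually (mem_interior_iff_mem_nhds.mp hx))⟩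
  have hdense := (((hd 0).inter_of_isOpen_left (hd 1) (hop 0)).inter_of_isOpen_left (hd 2)
    ((hop 0).inter (hop 1))).inter_of_isOpen_left (hd 3) (((hop 0).inter (hop 1)).inter (hop 2))
  have le (y) : supNorm (L.planePeakData.g ε) y ≤ L.planeNorm ε y :=
    supNorm_le (norm_le_supNorm y) fun p => norm_apply_le_supNorm hCf (Sum.inr p) y
  have hcont : Continuous (supNorm (L.planePeakData.g ε)) := by
    refine (LipschitzWith.of_le_add_mul ⟨2, by norm_num⟩ fun x y => ?_).continuous
    have h1 := supNorm_add_le hC y (x - y)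
    rw [add_sub_cancel] at h1
    refine h1.trans (add_le_add_right ((supNorm_le_mul hC (by linarith) _).trans ?_) _)
    rw [dist_eq_norm]
    exact mul_le_mul_of_nonneg_right (by change _ ≤ (2 : ℝ); linarith) (norm_nonneg _)
  -- The new norm is at most twice the old one, so radius 1/26 lies within radius 1/13.
  have hq (y) (hy : y ∈ Metric.ball x₀ (1 / 26)) : L.planeNorm ε y = ‖F y‖ := by
    refine hF.2 y ((supNorm_le_mul hCf one_le_two _).trans ?_)
    rw [mem_ball_iff_norm] at hy
    linarith
  have heq : Metric.ball x₀ (1 / 26) ⊆ {y | supNorm (L.planePeakData.g ε) y = ‖F y‖} := by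
    refine (hdense.open_subset_closure_inter Metric.isOpen_ball).trans
      (closure_minimal ?_ (isClosed_eq hcont (by fun_prop)))
    rintro y ⟨hy, ⟨⟨hy0, hy1⟩, hy2⟩, hy3⟩
    have hyj (j : Fin 4) : ‖special Z j y‖ < L.planeNorm ε y := by
      refine lt_of_le_of_ne (norm_apply_le_supNorm hCf (Sum.inl j) y) fun h => ?_
      rw [hq y hy] at h
      fin_cases j
      · exact hy0 h.symm
      · exact hy1 h.symm
      · exact hy2 h.symm
      · exact hy3 h.symm
    have hsup : Finset.univ.sup' Finset.univ_nonempty (fun j : Fin 4 => ‖special Z j y‖) <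
        L.planeNorm ε y := (Finset.sup'_lt_iff _).mpr fun j _ => hyj j
    change supNorm (L.planePeakData.g ε) y = ‖F y‖
    rw [← hq y hy]
    refine le_antisymm (le y) ?_
    have hle : L.planeNorm ε y ≤ max (supNorm (L.planePeakData.g ε) y)
        (Finset.univ.sup' Finset.univ_nonempty (fun j : Fin 4 => ‖special Z j y‖)) := by
      refine supNorm_le ((norm_le_supNorm y).trans (le_max_left _ _)) fun i => ?_
      rcases i with j | p
      · exact (Finset.le_sup' (fun j : Fin 4 => ‖special Z j y‖) (Finset.mem_univ j)).trans
          (le_max_right _ _)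
      · exact (norm_apply_le_supNorm hC p y).trans (le_max_left _ _)
    exact (le_max_iff.mp hle).resolve_right (not_le.mpr hsup)
  exact L.not_flat_g hε hε' F x₀ ((le x₀).trans hF.1.le) heq

end LinkedSystem

/-! ### Chirality of the four special vectors. -/

namespace PlaneSum

/-- The determinants of pairs of the four vectors. -/
noncomputable def vecDet (i j : Fin 4) : ℂ := (vec i).1 * (vec j).2 - (vec i).2 * (vec j).1

/-- The squared moduli of the determinants, multiplied by `4225`. -/
def detTable : Fin 4 → Fin 4 → ℕ :=
  ![![0, 4225, 2704, 3600], ![4225, 0, 1521, 625], ![2704, 1521, 0, 1696], ![3600, 625, 1696, 0]]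

theorem norm_vecDet_sq (i j : Fin 4) : ‖vecDet i j‖ ^ 2 * 4225 = detTable i j := by
  rw [← Complex.normSq_eq_norm_sq, Complex.normSq_apply]
  fin_cases i <;> fin_cases j <;> simp [vecDet, vec, detTable] <;> norm_num

/-- Moduli of determinants survive unimodular factors. The ratios 3/5, 4/5, 5/13 and 12/13 occur for
only one ordering, by a finite check. -/
theorem eq_of_detTable : ∀ a b c d : Fin 4,
    (a ≠ b ∧ 25 * detTable c b = 9 * detTable a b ∧ 25 * detTable c a = 16 * detTable a b) ∧
      (169 * detTable d b = 25 * detTable a b ∧ 169 * detTable d a = 144 * detTable a b) →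
    a = 0 ∧ b = 1 ∧ c = 2 ∧ d = 3 := by
  decide

theorem detTable_eq {m n : ℕ} {i j k l : Fin 4} {p q : ℂ} (hp : ‖p‖ = m) (hq : ‖q‖ = n)
    (h : p * vecDet i j = q * vecDet k l) : m ^ 2 * detTable i j = n ^ 2 * detTable k l := by
  have h1 := congrArg (fun z => ‖z‖ ^ 2) h
  simp only [norm_mul, hp, hq, mul_pow] at h1
  have h2 : ((m ^ 2 * detTable i j : ℕ) : ℝ) = (n ^ 2 * detTable k l : ℕ) := by
    push_cast
    rw [← norm_vecDet_sq, ← norm_vecDet_sq]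
    linear_combination 4225 * h1
  exact_mod_cast h2

/-- Chirality: the four vectors are not permuted, up to unimodular factors, by an antilinear map. -/
theorem vec_chiral {k : Fin 4 → Fin 4} {c : Fin 4 → ℂ} (hc : ∀ j, ‖c j‖ = 1) (hk : k 0 ≠ k 1)
    (h2 : 5 * (c 2 • vec (k 2)) = 3 * (c 0 • vec (k 0)) + 4 * (c 1 • vec (k 1)))
    (h3 : 13 * (c 3 • vec (k 3)) = 5 * (c 0 • vec (k 0)) -
      (12 * Complex.I) • (c 1 • vec (k 1))) : False := by
  have h21 := congrArg Prod.fst h2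
  have h22 := congrArg Prod.snd h2
  have h31 := congrArg Prod.fst h3
  have h32 := congrArg Prod.snd h3
  simp only [Prod.fst_mul, Prod.snd_mul, Prod.fst_add, Prod.snd_add, Prod.fst_sub, Prod.snd_sub,
    Prod.smul_fst, Prod.smul_snd, smul_eq_mul, Prod.fst_ofNat, Prod.snd_ofNat] at h21 h22 h31 h32
  obtain ⟨k0, k1, k2, k3⟩ := eq_of_detTable (k 0) (k 1) (k 2) (k 3) ⟨⟨hk,
    detTable_eq (m := 5) (n := 3) (p := 5 * c 2) (q := 3 * c 0) (by simp [hc]) (by simp [hc])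
      (by simp only [vecDet]; linear_combination (vec (k 1)).2 * h21 - (vec (k 1)).1 * h22),
    detTable_eq (m := 5) (n := 4) (p := 5 * c 2) (q := -(4 * c 1)) (by simp [hc]) (by simp [hc])
      (by simp only [vecDet]; linear_combination (vec (k 0)).2 * h21 - (vec (k 0)).1 * h22)⟩,
    detTable_eq (m := 13) (n := 5) (p := 13 * c 3) (q := 5 * c 0) (by simp [hc]) (by simp [hc])
      (by simp only [vecDet]; linear_combination (vec (k 1)).2 * h31 - (vec (k 1)).1 * h32),
    detTable_eq (m := 13) (n := 12) (p := 13 * c 3) (q := 12 * Complex.I * c 1)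
      (by simp [hc]) (by simp [hc])
      (by simp only [vecDet]; linear_combination (vec (k 0)).2 * h31 - (vec (k 0)).1 * h32)⟩
  -- With the identity permutation the first relation gives c 0 = c 1 = c 2. The second, with i
  -- conjugated, gives c 3 = c 0 and c 3 = -c 1, so c 1 = 0.
  rw [k0, k1, k2] at h21 h22
  rw [k0, k1, k3] at h31 h32
  simp [vec] at h21 h22 h31 h32
  have e : c 1 * Complex.I = 0 := by
    linear_combination (h32 - (12 / 5) * Complex.I * h31 +
      (12 / 3) * Complex.I * h21 - 3 * Complex.I * h22) / 24
  have := hc 1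
  simp at e
  simp [e] at this

end PlaneSum

/-! ### Absence of antilinear isometries. -/

namespace LinkedSystem

open PlaneSum

variable {Z : Type u} [NormedAddCommGroup Z] [NormedSpace ℂ Z] {A : Type v}
  (L : LinkedSystem ℂ Z A 1) {ε : ℝ}

/-- The conjugate of a special functional composed with an antilinear isometry. -/
noncomputable def conjComp {T : PlaneSum Z ≃ₗ[ℝ] PlaneSum Z} {C : ℝ}
    (hT : ∀ w, ‖T w‖ ≤ C * ‖w‖) (hTI : ∀ w, T (Complex.I • w) = -(Complex.I • T w))
    (F : PlaneSum Z →L[ℂ] ℂ) : PlaneSum Z →L[ℂ] ℂ :=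
  LinearMap.mkContinuous
    { toFun := fun w => (starRingEnd ℂ) (F (T w))
      map_add' := fun x y => by simp
      map_smul' := fun z w => by
        have h : T (z • w) = (starRingEnd ℂ) z • T w := by
          conv_lhs => rw [← Complex.re_add_im z, add_smul, mul_smul, Complex.coe_smul,
            Complex.coe_smul, map_add, map_smul, map_smul, hTI, smul_neg, ← Complex.coe_smul,
            ← Complex.coe_smul, smul_smul, ← neg_smul, ← add_smul]
          congr 1
          apply Complex.ext <;> simp
        rw [h, map_smul]
        simp } (‖F‖ * C) fun w => by
    refine (Complex.norm_conj _).le.trans ((F.le_opNorm _).trans ?_)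
    rw [mul_assoc]
    exact mul_le_mul_of_nonneg_left (hT w) (norm_nonneg F)

/-- The functional conj(s_j ∘ T) is complex-linear and flat, hence a unimodular multiple of a
special one. These functionals satisfy the conjugates of the linear relations among the s_j,
contradicting `vec_chiral`. -/
theorem no_antilinear_isometry (hε : 0 < ε) (hε' : ε ≤ 1 / 20000) :
    ¬∃ T : PlaneSum Z ≃ₗ[ℝ] PlaneSum Z, (∀ w, L.planeNorm ε (T w) = L.planeNorm ε w) ∧
      ∀ w, T (Complex.I • w) = -(Complex.I • T w) := by
  rintro ⟨T, hT, hTI⟩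
  have hε8 : ε ≤ 1 / 8 := by linarith
  have hTb : ∀ w, ‖T w‖ ≤ 2 * ‖w‖ := fun w => by
    refine (norm_le_supNorm (G := L.planePeakData.family (special Z) ε) (T w)).trans
      ((hT w).trans_le (supNorm_le_mul (L.planePeakData.norm_family _ hε hε8 norm_special)
        one_le_two w))
  set F : Fin 4 → PlaneSum Z →L[ℂ] ℂ := fun j => conjComp hTb hTI (special Z j) with hF
  have hFa (j : Fin 4) (w : PlaneSum Z) : F j w = (starRingEnd ℂ) (special Z j (T w)) := rfl
  have hflat (j : Fin 4) : IsFlat (L.planeNorm ε) (F j) (T.symm (peak Z j)) := by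
    have h := L.isFlat_special hε hε8 j
    refine ⟨?_, fun y hy => ?_⟩
    · rw [← hT, LinearEquiv.apply_symm_apply]
      exact h.1
    · rw [← hT, hFa, Complex.norm_conj]
      refine h.2 _ ?_
      rwa [← hT, map_sub, LinearEquiv.apply_symm_apply] at hy
  choose k c hc hk using fun j => L.exists_eq_special_of_isFlat hε hε' (hflat j)
  have hkF (j : Fin 4) (a b : ℂ) :
      F j (plane a b) = 2 * (c j * ((vec (k j)).1 * a + (vec (k j)).2 * b)) := by
    rw [hk j, smul_apply, smul_eq_mul, special_apply, plane_fst_zero, plane_fst_one]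
    ring
  have r2 (w : PlaneSum Z) : 5 * F 2 w = 3 * F 0 w + 4 * F 1 w := by
    simp only [hFa, special_apply, vec, Matrix.cons_val_zero, Matrix.cons_val_one, Matrix.cons_val]
    simp only [map_mul, map_add, map_div₀, Complex.conj_ofNat, map_one, map_zero]
    ring
  have r3 (w : PlaneSum Z) : 13 * F 3 w = 5 * F 0 w - 12 * Complex.I * F 1 w := by
    simp only [hFa, special_apply, vec, Matrix.cons_val_zero, Matrix.cons_val_one, Matrix.cons_val]
    simp only [map_mul, map_add, map_div₀, Complex.conj_ofNat, map_one, map_zero, Complex.conj_I]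
    ring
  refine vec_chiral (k := k) hc (fun h01 => ?_) ?_ ?_
  -- If k 0 = k 1, then F 0 and F 1 are proportional, yet this point gives them the values 2 and 0.
  · have h0 : F 0 (T.symm (plane 1 0)) = 2 := by
      rw [hFa, LinearEquiv.apply_symm_apply]
      simp [special_apply, vec, Complex.conj_ofNat]
    have h1 : F 1 (T.symm (plane 1 0)) = 0 := by
      rw [hFa, LinearEquiv.apply_symm_apply]
      simp [special_apply, vec]
    have hc1 : c 1 ≠ 0 := norm_ne_zero_iff.mp (by rw [hc 1]; exact one_ne_zero)
    rw [hk 0, smul_apply, h01] at h0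
    rw [hk 1, smul_apply, smul_eq_mul] at h1
    rw [(mul_eq_zero.mp h1).resolve_left hc1] at h0
    simp at h0
  · refine Prod.ext ?_ ?_
    · have := r2 (plane 1 0)
      simp only [hkF] at this
      simp
      linear_combination this / 2
    · have := r2 (plane 0 1)
      simp only [hkF] at this
      simp
      linear_combination this / 2
  · refine Prod.ext ?_ ?_
    · have := r3 (plane 1 0)
      simp only [hkF] at this
      simp
      linear_combination this / 2
    · have := r3 (plane 0 1)
      simp only [hkF] at this
      simp
      linear_combination this / 2

theorem exists_card_eq_two {X : Type*} [NormedAddCommGroup X] [NormedSpace ℝ X]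
    (L : LinkedSystem ℂ Z A 1) (e : X ≃L[ℝ] PlaneSum Z) :
    ∃ N : EquivalentNorm X, Nat.card (ComplexStructuresUpToIsometry N.Space) = 2 := by
  have hε : (0 : ℝ) < 1 / 20000 := by norm_num
  have hε8 : (1 / 20000 : ℝ) ≤ 1 / 8 := by norm_num
  exact ⟨_, card_eq_two_of_rigid e (L.planePeakData.norm_family _ hε hε8 norm_special)
    one_le_two (L.plane_rigid hε hε8) (L.no_antilinear_isometry hε le_rfl)⟩

end LinkedSystem

/-! ### Splitting off a plane, and conclusion. -/

/-- A complex normed space of dimension at least two is the sum of a plane and another space. -/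
theorem exists_equiv_plane_prod (W : Type u) [NormedAddCommGroup W] [NormedSpace ℂ W]
    (h : 2 ≤ Module.rank ℂ W) :
    ∃ K : Submodule ℂ W, Nonempty (W ≃L[ℂ] EuclideanSpace ℂ (Fin 2) × K) := by
  obtain ⟨s, hs, hli⟩ := le_rank_iff_exists_linearIndependent_finset.mp
    (show ((2 : ℕ) : Cardinal) ≤ Module.rank ℂ W by exact_mod_cast h)
  set V := Submodule.span ℂ (s : Set W) with hV
  have hfin : FiniteDimensional ℂ V := FiniteDimensional.span_finset ℂ s
  have hrank : Module.finrank ℂ V = Module.finrank ℂ (EuclideanSpace ℂ (Fin 2)) := by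
    rw [finrank_euclideanSpace_fin, ← hs]
    exact finrank_span_finset_eq_card hli
  let e : V ≃L[ℂ] EuclideanSpace ℂ (Fin 2) :=
    (LinearEquiv.ofFinrankEq _ _ hrank).toContinuousLinearEquiv
  obtain ⟨p, hp⟩ := Submodule.ClosedComplemented.of_finiteDimensional (𝕜 := ℂ) V
  refine ⟨_, ⟨ContinuousLinearEquiv.equivOfRightInverse ((e : V →L[ℂ] _).comp p)
    (V.subtypeL.comp (e.symm : _ →L[ℂ] V)) fun v => ?_⟩⟩
  simp [hp]

/-- A Banach space of dimension at least four which admits a complex structure up to isomorphism has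
an equivalent norm with exactly two complex structures. -/
theorem exists_equivalentNorm_card_eq_two (X : Type u) [NormedAddCommGroup X] [NormedSpace ℝ X]
    (hr : 4 ≤ Module.rank ℝ X) (hX : HasComplexStructureUpToIsomorphism X) :
    ∃ N : EquivalentNorm X, Nat.card (ComplexStructuresUpToIsometry N.Space) = 2 := by
  obtain ⟨I, hI⟩ := hX
  have hI' : ∀ v, I (I v) = -v := fun v => by
    simpa using congrArg (fun T : X →L[ℝ] X => T v) hI
  have hrank : 2 ≤ Module.rank ℂ (ComplexSpace I hI') := by
    rw [(ComplexSpace.ofLinear I hI').rank_eq, rank_real_of_complex] at hr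
    by_contra hlt
    rw [not_le] at hlt
    obtain ⟨n, hn⟩ := Cardinal.lt_aleph0.mp (hlt.trans (Cardinal.natCast_lt_aleph0 (n := 2)))
    rw [hn] at hr hlt
    have h1 : 4 ≤ 2 * n := by exact_mod_cast hr
    have h2 : n < 2 := by exact_mod_cast hlt
    omega
  obtain ⟨K, ⟨e⟩⟩ := exists_equiv_plane_prod (ComplexSpace I hI') hrank
  obtain ⟨Z, _, _, A, ⟨eZ⟩, ⟨L⟩⟩ := exists_renormed_linkedSystem ℂ K
  let e' : ComplexSpace I hI' ≃L[ℂ] PlaneSum Z :=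
    (e.trans ((ContinuousLinearEquiv.refl ℂ (EuclideanSpace ℂ (Fin 2))).prodCongr eZ)).trans
      (WithLp.prodContinuousLinearEquiv 2 ℂ (EuclideanSpace ℂ (Fin 2)) Z).symm
  have e'' : ComplexSpace I hI' ≃L[ℝ] PlaneSum Z :=
    { e' with
      map_smul' := fun r w => by
        have h := e'.map_smul (r : ℂ) w
        rw [Complex.coe_smul, Complex.coe_smul] at h
        exact h }
  exact L.exists_card_eq_two ((ComplexSpace.ofL I hI').trans e'')

theorem theorem3p4 :
    (∀ (X : Type u) [NormedAddCommGroup X] [NormedSpace ℝ X] [CompleteSpace X],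
      4 ≤ Module.rank ℝ X → HasComplexStructureUpToIsomorphism X →
        ∃ N : EquivalentNorm X, Nat.card (ComplexStructuresUpToIsometry N.Space) = 2) ∧
    (∀ (X : Type u) [NormedAddCommGroup X] [NormedSpace ℝ X] [CompleteSpace X]
      (Y : Type v) [NormedAddCommGroup Y] [NormedSpace ℝ Y] [CompleteSpace Y],
      Nonempty (X ≃L[ℝ] (Y × Y)) →
        ∃ N : EquivalentNorm X, Nat.card (ComplexStructuresUpToIsometry N.Space) = 1) :=
  ⟨fun X _ _ _ hr hX => exists_equivalentNorm_card_eq_two X hr hX,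
    fun X _ _ _ Y _ _ _ ⟨e⟩ => exists_equivalentNorm_card_eq_one X Y e⟩
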